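/- For a transcendental real number $\xi$ and an integer $n\ge 1$, let $w_n^*(\xi)\in[-\infty,+\infty]$ be the supremum of the real numbers $w$ for which $$|\xi-\alpha|<H(\alpha)^{-w-1}$$ has infinitely many solutions in algebraic real numbers $\alpha$ of degree at most $n$, where $H(\alpha)$ is the naive height of $\alpha$, that is, the maximum modulus of the coefficients of the minimal polynomial of $\alpha$ over $\mathbb{Z}$ with coprime coefficients. Put $$\overline{w}^*(\xi)=\limsup_{n\to\infty}\frac{w_n^*(\xi)}{n},\qquad \underline{w}^*(\xi)=\liminf_{n\to\infty}\frac{w_n^*(\xi)}{n}.$$ Theorem. Let $\xi$ be any transcendental real number. For every integer $n\ge 4$, $$w_n^*(\xi)>\frac{1}{\sqrt 3}\,n=0.5773\ldots\, n .$$ In particular $\underline{w}^*(\xi)\ge 1/\sqrt 3$. Moreover, $$\overline{w}^*(\xi)\ge\delta,$$ where $\delta=0.6408\ldots$ is given as $G(\gamma_0)$ with $$G(t)=\frac{4(t-t^2)}{2t^2+2t-1+\sqrt{4t^4+24t^3-32t^2+12t+1}},$$ and $\gamma_0$ is the unique root of $Q(t)=4t^4-12t^3+10t^2-6t+1$ in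 the interval $(0,1/2)$. -/

import Mathlib

open Polynomial Filter

noncomputable section

/-- `P` is the minimal polynomial of `α` over `ℤ` with coprime coefficients
(such a polynomial exists exactly for algebraic `α`, and it is unique up to sign). -/
def IsIntegerMinpoly (P : ℤ[X]) (α : ℝ) : Prop :=
  P.IsPrimitive ∧ Irreducible P ∧ aeval α P = 0

/-- The algebraic real numbers `α` of degree at most `n` with `|ξ - α| < H(α) ^ (-w - 1)`.
The naive height `H(α)` is the maximum modulus of the coefficients of the integer minimal
polynomial of `α`, which is Mathlib's `Polynomial.supNorm`. -/
def wirsingSolutions (n : ℕ) (ξ w : ℝ) : Set ℝ :=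
  {α : ℝ | ∃ P : ℤ[X], IsIntegerMinpoly P α ∧ P.natDegree ≤ n ∧
    |ξ - α| < P.supNorm ^ (-w - 1)}

/-- Wirsing's exponent `w*_n(ξ)`: the supremum, in the extended reals, of the real numbers `w`
for which `|ξ - α| < H(α) ^ (-w - 1)` has infinitely many solutions in algebraic real numbers
`α` of degree at most `n`. It may be `+∞`. -/
def wStar (n : ℕ) (ξ : ℝ) : EReal :=
  sSup {w : EReal | ∃ r : ℝ, w = (r : EReal) ∧ (wirsingSolutions n ξ r).Infinite}

/-- The upper limit of `w*_n(ξ) / n` as `n → ∞`. -/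
def upperWStar (ξ : ℝ) : EReal :=
  limsup (fun n : ℕ => wStar n ξ / ((n : ℝ) : EReal)) atTop

/-- The lower limit of `w*_n(ξ) / n` as `n → ∞`. -/
def lowerWStar (ξ : ℝ) : EReal :=
  liminf (fun n : ℕ => wStar n ξ / ((n : ℝ) : EReal)) atTop

/-- The algebraic function `G` (its denominator is positive on `(0, 1/2)`). -/
def wirsingG (t : ℝ) : ℝ :=
  4 * (t - t ^ 2) /
    (2 * t ^ 2 + 2 * t - 1 + Real.sqrt (4 * t ^ 4 + 24 * t ^ 3 - 32 * t ^ 2 + 12 * t + 1))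

/-- The quartic polynomial `Q`. -/
def wirsingQ (t : ℝ) : ℝ :=
  4 * t ^ 4 - 12 * t ^ 3 + 10 * t ^ 2 - 6 * t + 1

end

/-! ### Heights and values of integer polynomials -/

theorem one_le_supNorm {T : ℤ[X]} (hT : T ≠ 0) : 1 ≤ T.supNorm := by
  have h := T.le_supNorm T.natDegree
  refine le_trans ?_ h
  rw [Int.norm_eq_abs]
  exact_mod_cast Int.one_le_abs (leadingCoeff_ne_zero.mpr hT)

theorem supNorm_le_of_coeff {T : ℤ[X]} {B : ℝ} (h : ∀ i, |(T.coeff i : ℝ)| ≤ B) :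
    T.supNorm ≤ B := by
  obtain ⟨i, hi⟩ := T.exists_eq_supNorm
  rw [hi, Int.norm_eq_abs]
  exact h i

theorem abs_coeff_le_supNorm (T : ℤ[X]) (i : ℕ) : |(T.coeff i : ℝ)| ≤ T.supNorm := by
  have := T.le_supNorm i
  rwa [Int.norm_eq_abs] at this

theorem supNorm_X_pow_mul_le (T : ℤ[X]) (j : ℕ) : (X ^ j * T).supNorm ≤ T.supNorm := by
  apply supNorm_le_of_coeff
  intro i
  rw [coeff_X_pow_mul']
  split_ifs
  · exact abs_coeff_le_supNorm _ _
  · simpa using T.supNorm_nonneg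

theorem supNorm_map_complex (T : ℤ[X]) : (T.map (Int.castRingHom ℂ)).supNorm = T.supNorm := by
  apply le_antisymm
  · obtain ⟨i, hi⟩ := (T.map (Int.castRingHom ℂ)).exists_eq_supNorm
    rw [hi, coeff_map]
    simpa [Int.norm_eq_abs] using abs_coeff_le_supNorm T i
  · apply supNorm_le_of_coeff
    intro i
    have := (T.map (Int.castRingHom ℂ)).le_supNorm i
    rw [coeff_map] at this
    simpa using this

/-- The Mahler measure of an integer polynomial. -/
noncomputable def intMahler (T : ℤ[X]) : ℝ := (T.map (Int.castRingHom ℂ)).mahlerMeasure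

theorem intMahler_mul (A B : ℤ[X]) : intMahler (A * B) = intMahler A * intMahler B := by
  rw [intMahler, Polynomial.map_mul, mahlerMeasure_mul]; rfl

theorem one_le_intMahler {T : ℤ[X]} (hT : T ≠ 0) : 1 ≤ intMahler T :=
  one_le_mahlerMeasure_of_ne_zero hT

theorem supNorm_le_intMahler {T : ℤ[X]} {n : ℕ} (h : T.natDegree ≤ n) :
    T.supNorm ≤ 2 ^ n * intMahler T := by
  rw [← supNorm_map_complex]
  refine (supNorm_le_choose_natDegree_div_two_mul_mahlerMeasure _).trans ?_
  unfold intMahler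
  gcongr
  · exact mahlerMeasure_nonneg _
  · have h1 : (T.map (Int.castRingHom ℂ)).natDegree ≤ n := natDegree_map_le.trans h
    calc ((Nat.choose _ _ : ℕ) : ℝ) ≤ ((2 ^ (T.map (Int.castRingHom ℂ)).natDegree : ℕ) : ℝ) := by
          exact_mod_cast Nat.choose_le_two_pow _ _
      _ ≤ 2 ^ n := by
          push_cast
          exact pow_le_pow_right₀ (by norm_num) h1

theorem intMahler_le_supNorm {T : ℤ[X]} {n : ℕ} (h : T.natDegree ≤ n) :
    intMahler T ≤ (n + 1) * T.supNorm := by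
  rw [← supNorm_map_complex]
  refine (mahlerMeasure_le_sqrt_natDegree_add_one_mul_supNorm _).trans ?_
  gcongr
  · exact supNorm_nonneg _
  · have h1 : (T.map (Int.castRingHom ℂ)).natDegree ≤ n := natDegree_map_le.trans h
    have h2 : ((T.map (Int.castRingHom ℂ)).natDegree : ℝ) ≤ n := by exact_mod_cast h1
    rw [Real.sqrt_le_iff]
    constructor
    · positivity
    · nlinarith [Nat.cast_nonneg (α := ℝ) n]

/-- The constant in Gelfond's inequality for degree at most `n`. -/
noncomputable def gelfondConst (n : ℕ) : ℝ := 4 ^ n * (n + 1)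

theorem one_le_gelfondConst (n : ℕ) : 1 ≤ gelfondConst n := by
  unfold gelfondConst
  have h1 : (1 : ℝ) ≤ 4 ^ n := one_le_pow₀ (by norm_num)
  have h2 : (1 : ℝ) ≤ n + 1 := by simp
  nlinarith

theorem supNorm_mul_supNorm_le {A B : ℤ[X]} {n : ℕ} (hA : A ≠ 0) (hB : B ≠ 0)
    (h : (A * B).natDegree ≤ n) :
    A.supNorm * B.supNorm ≤ gelfondConst n * (A * B).supNorm := by
  rw [natDegree_mul hA hB] at h
  have h1 := supNorm_le_intMahler (T := A) (n := n) (by omega)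
  have h2 := supNorm_le_intMahler (T := B) (n := n) (by omega)
  have h3 := intMahler_le_supNorm (T := A * B) (n := n) (by rwa [natDegree_mul hA hB])
  rw [intMahler_mul] at h3
  calc A.supNorm * B.supNorm ≤ (2 ^ n * intMahler A) * (2 ^ n * intMahler B) := by
        gcongr
        · exact supNorm_nonneg _
        · exact h1.trans' (supNorm_nonneg _)
    _ = 4 ^ n * (intMahler A * intMahler B) := by
        rw [show (4 : ℝ) = 2 * 2 by norm_num, mul_pow]; ring
    _ ≤ 4 ^ n * ((n + 1) * (A * B).supNorm) := by gcongr
    _ = _ := by unfold gelfondConst; ring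

theorem finite_supNorm_le (n : ℕ) (B : ℝ) : {T : ℤ[X] | T.natDegree ≤ n ∧ T.supNorm ≤ B}.Finite := by
  have h := finite_mahlerMeasure_le n (((n + 1) * B).toNNReal)
  refine h.subset ?_
  rintro T ⟨h1, h2⟩
  refine ⟨h1, ?_⟩
  have h3 := intMahler_le_supNorm h1
  have h4 : intMahler T ≤ (n + 1) * B := h3.trans (by gcongr)
  exact h4.trans (Real.le_coe_toNNReal _)

theorem aeval_ne_zero_of_transcendental {ξ : ℝ} (hξ : Transcendental ℚ ξ) {T : ℤ[X]} (hT : T ≠ 0) :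
    aeval ξ T ≠ 0 := by
  have h : Transcendental ℤ ξ := fun h => hξ (by
    exact (IsFractionRing.isAlgebraic_iff ℤ ℚ ℝ).mp h)
  intro h0
  exact hT ((transcendental_iff.mp h) T h0)

/-- A uniform bound for the Taylor coefficients at `ξ` of polynomials of degree at most `n` and
height one. -/
noncomputable def taylorConst (n : ℕ) (ξ : ℝ) : ℝ := 2 ^ n * (n + 1) * (1 + |ξ|) ^ n

theorem one_le_taylorConst (n : ℕ) (ξ : ℝ) : 1 ≤ taylorConst n ξ := by
  unfold taylorConst
  have h1 : (1 : ℝ) ≤ 2 ^ n := one_le_pow₀ (by norm_num)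
  have h2 : (1 : ℝ) ≤ n + 1 := by simp
  have h3 : (1 : ℝ) ≤ (1 + |ξ|) ^ n := one_le_pow₀ (by simp)
  have := one_le_mul_of_one_le_of_one_le h1 h2
  exact one_le_mul_of_one_le_of_one_le this h3

theorem abs_taylor_coeff_le {T : ℤ[X]} {n : ℕ} (h : T.natDegree ≤ n) (ξ : ℝ) (i : ℕ) :
    |(taylor ξ (T.map (Int.castRingHom ℝ))).coeff i| ≤ taylorConst n ξ * T.supNorm := by
  have hdeg : (hasseDeriv i (T.map (Int.castRingHom ℝ))).natDegree < n + 1 := by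
    have := natDegree_hasseDeriv_le (T.map (Int.castRingHom ℝ)) i
    have h1 : (T.map (Int.castRingHom ℝ)).natDegree ≤ n := natDegree_map_le.trans h
    omega
  rw [taylor_coeff, eval_eq_sum_range' hdeg]
  refine (Finset.abs_sum_le_sum_abs _ _).trans ?_
  have key : ∀ j ∈ Finset.range (n + 1),
      |(hasseDeriv i (T.map (Int.castRingHom ℝ))).coeff j * ξ ^ j| ≤
        2 ^ n * T.supNorm * (1 + |ξ|) ^ n := by
    intro j hj
    have hj' : j ≤ n := by simpa [Nat.lt_succ_iff] using hj
    rw [hasseDeriv_coeff, coeff_map, abs_mul, abs_mul, abs_pow]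
    by_cases hij : j + i ≤ n
    · gcongr
      · have := T.supNorm_nonneg
        positivity
      · rw [abs_of_nonneg (by positivity)]
        calc (((j + i).choose i : ℕ) : ℝ) ≤ ((2 ^ (j + i) : ℕ) : ℝ) := by
              exact_mod_cast Nat.choose_le_two_pow _ _
          _ ≤ 2 ^ n := by push_cast; exact pow_le_pow_right₀ (by norm_num) hij
      · exact abs_coeff_le_supNorm T _
      · calc |ξ| ^ j ≤ (1 + |ξ|) ^ j := by gcongr; simp
          _ ≤ (1 + |ξ|) ^ n := pow_le_pow_right₀ (by simp) hj'
    · rw [coeff_eq_zero_of_natDegree_lt (by omega)]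
      have := T.supNorm_nonneg
      simp only [map_zero, abs_zero, mul_zero, zero_mul]
      positivity
  refine (Finset.sum_le_card_nsmul _ _ _ key).trans (le_of_eq ?_)
  simp [taylorConst]
  ring

theorem taylor_coeff_zero_eq_aeval (T : ℤ[X]) (ξ : ℝ) :
    (taylor ξ (T.map (Int.castRingHom ℝ))).coeff 0 = aeval ξ T := by
  rw [taylor_coeff_zero, eval_map, aeval_def]; rfl

theorem taylor_coeff_one_eq_aeval (T : ℤ[X]) (ξ : ℝ) :
    (taylor ξ (T.map (Int.castRingHom ℝ))).coeff 1 = aeval ξ (derivative T) := by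
  rw [taylor_coeff_one, derivative_map, eval_map, aeval_def]; rfl

theorem abs_aeval_le {T : ℤ[X]} {n : ℕ} (h : T.natDegree ≤ n) (ξ : ℝ) :
    |aeval ξ T| ≤ taylorConst n ξ * T.supNorm := by
  rw [← taylor_coeff_zero_eq_aeval]; exact abs_taylor_coeff_le h ξ 0

theorem abs_aeval_derivative_le {T : ℤ[X]} {n : ℕ} (h : T.natDegree ≤ n) (ξ : ℝ) :
    |aeval ξ (derivative T)| ≤ taylorConst n ξ * T.supNorm := by
  rw [← taylor_coeff_one_eq_aeval]; exact abs_taylor_coeff_le h ξ 1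

theorem abs_aeval_add_sub_le {T : ℤ[X]} {n : ℕ} (hT : T.natDegree ≤ n) (ξ h : ℝ) (hh : |h| ≤ 1) :
    |aeval (ξ + h) T - aeval ξ T - aeval ξ (derivative T) * h| ≤
      (n + 1) * taylorConst n ξ * T.supNorm * h ^ 2 := by
  set F := taylor ξ (T.map (Int.castRingHom ℝ)) with hF
  have hdeg : F.natDegree < n + 2 := by
    have h1 : (T.map (Int.castRingHom ℝ)).natDegree ≤ n := natDegree_map_le.trans hT
    rw [hF, natDegree_taylor]; omega
  have h1 : aeval (ξ + h) T = F.eval h := by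
    rw [hF, taylor_eval, eval_map, aeval_def, add_comm]; rfl
  rw [h1, eval_eq_sum_range' hdeg, Finset.sum_range_succ', Finset.sum_range_succ']
  have e0 : F.coeff 0 = aeval ξ T := taylor_coeff_zero_eq_aeval T ξ
  have e1 : F.coeff 1 = aeval ξ (derivative T) := taylor_coeff_one_eq_aeval T ξ
  simp only [zero_add, pow_zero, pow_one, mul_one, e0, e1]
  rw [show ∀ s a b : ℝ, s + b + a - a - b = s by intros; ring]
  refine (Finset.abs_sum_le_sum_abs _ _).trans ?_
  have key : ∀ j ∈ Finset.range n, |F.coeff (j + 1 + 1) * h ^ (j + 1 + 1)| ≤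
      taylorConst n ξ * T.supNorm * h ^ 2 := by
    intro j _
    rw [abs_mul]
    gcongr
    · have := T.supNorm_nonneg
      have := one_le_taylorConst n ξ
      positivity
    · exact abs_taylor_coeff_le hT ξ _
    · rw [abs_pow, add_assoc, ← sq_abs h]
      calc |h| ^ (j + (1 + 1)) = |h| ^ j * |h| ^ 2 := by ring
        _ ≤ 1 * |h| ^ 2 := by gcongr; exact pow_le_one₀ (abs_nonneg _) hh
        _ = _ := by simp
  refine (Finset.sum_le_card_nsmul _ _ _ key).trans ?_
  rw [Finset.card_range, nsmul_eq_mul]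
  have h3 : 0 ≤ taylorConst n ξ * T.supNorm * h ^ 2 := by
    have := T.supNorm_nonneg
    have := one_le_taylorConst n ξ
    positivity
  nlinarith

/-! ### Real roots near `ξ` and the resulting bound for the derivative -/

theorem exists_real_root_near {T : ℤ[X]} {n : ℕ} (hT : T.natDegree ≤ n) (ξ : ℝ)
    (hD : aeval ξ (derivative T) ≠ 0)
    (h : 4 * ((n + 1) * taylorConst n ξ * T.supNorm) * |aeval ξ T| ≤ aeval ξ (derivative T) ^ 2) :
    ∃ α : ℝ, aeval α T = 0 ∧ |ξ - α| ≤ 2 * |aeval ξ T| / |aeval ξ (derivative T)| := by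
  set a := aeval ξ T with ha
  set D := aeval ξ (derivative T) with hDdef
  set K := (n + 1) * taylorConst n ξ * T.supNorm with hK
  have hT0 : T ≠ 0 := by
    rintro rfl
    simp [hDdef] at hD
  have hH := one_le_supNorm hT0
  have hC := one_le_taylorConst n ξ
  have hCT : 1 ≤ taylorConst n ξ * T.supNorm := one_le_mul_of_one_le_of_one_le hC hH
  have hKle : taylorConst n ξ * T.supNorm ≤ K := by
    rw [hK, mul_assoc]
    exact le_mul_of_one_le_left (by linarith) (by simp)
  have haK : |a| ≤ K := (abs_aeval_le hT ξ).trans hKle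
  have hD2 : 0 < D ^ 2 := by positivity
  set r := -2 * a / D with hr
  have hr2 : r ^ 2 * D ^ 2 = 4 * |a| ^ 2 := by
    rw [hr, sq_abs]; field_simp; ring
  have hKpos : 0 < K := by linarith
  have hKr : K * r ^ 2 ≤ |a| := by
    have h1 : (K * r ^ 2) * D ^ 2 ≤ |a| * D ^ 2 := by
      calc (K * r ^ 2) * D ^ 2 = (4 * K * |a|) * |a| := by
            rw [mul_assoc, hr2]; ring
        _ ≤ D ^ 2 * |a| := by gcongr
        _ = _ := by ring
    exact le_of_mul_le_mul_right h1 hD2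
  have hr1 : |r| ≤ 1 := by
    rw [← sq_le_one_iff_abs_le_one]
    have : K * r ^ 2 ≤ K * 1 := by linarith
    exact le_of_mul_le_mul_left this hKpos
  have hE := abs_aeval_add_sub_le hT ξ r hr1
  rw [← ha, ← hDdef, ← hK] at hE
  have hDr : D * r = -2 * a := by rw [hr]; field_simp
  rw [hDr] at hE
  have hE' := abs_le.mp (hE.trans hKr)
  have hcont : ContinuousOn (fun x : ℝ => aeval x T) (Set.uIcc ξ (ξ + r)) :=
    (Polynomial.continuous_aeval T).continuousOn
  have hmem : (0 : ℝ) ∈ Set.uIcc (aeval ξ T) (aeval (ξ + r) T) := by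
    rw [← ha, Set.mem_uIcc]
    rcases le_total 0 a with h0 | h0
    · rw [abs_of_nonneg h0] at hE'
      right; constructor <;> linarith [hE'.1, hE'.2]
    · rw [abs_of_nonpos h0] at hE'
      left; constructor <;> linarith [hE'.1, hE'.2]
  obtain ⟨α, hα, hα0⟩ := intermediate_value_uIcc hcont hmem
  refine ⟨α, hα0, ?_⟩
  have h2 := Set.abs_sub_left_of_mem_uIcc hα
  rw [abs_sub_comm]
  refine h2.trans (le_of_eq ?_)
  rw [add_sub_cancel_left, hr, abs_div, abs_mul]; norm_num

theorem exists_integerMinpoly_dvd {T : ℤ[X]} (hT : T ≠ 0) {α : ℝ} (hα : aeval α T = 0) :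
    ∃ A : ℤ[X], IsIntegerMinpoly A α ∧ A ∣ T := by
  induction T using WfDvdMonoid.induction_on_irreducible with
  | zero => exact absurd rfl hT
  | unit u hu =>
    exfalso
    obtain ⟨r, hr, rfl⟩ := Polynomial.isUnit_iff.mp hu
    rw [aeval_C] at hα
    have : r = 0 := by simpa using hα
    exact hr.ne_zero this
  | mul a i ha hi ih =>
    rw [map_mul] at hα
    rcases mul_eq_zero.mp hα with h | h
    · refine ⟨i, ⟨hi.isPrimitive ?_, hi, h⟩, dvd_mul_right _ _⟩
      intro h0
      obtain ⟨r, rfl⟩ := natDegree_eq_zero.mp h0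
      rw [aeval_C] at h
      have : r = 0 := by simpa using h
      exact hi.ne_zero (by simp [this])
    · obtain ⟨A, hA, hd⟩ := ih ha h
      exact ⟨A, hA, hd.mul_left _⟩

/-- All real algebraic numbers of degree at most `n` satisfy `|ξ - α| ≫ H(α) ^ (-ω - 1)`. -/
def ApproxBound (n : ℕ) (ξ ω : ℝ) : Prop :=
  ∃ c : ℝ, 0 < c ∧ ∀ (α : ℝ) (P : ℤ[X]), IsIntegerMinpoly P α → P.natDegree ≤ n →
    c * P.supNorm ^ (-ω - 1) ≤ |ξ - α|

theorem ApproxBound.derivative_bound {n : ℕ} {ξ ω : ℝ} (hω : 0 ≤ ω) (h : ApproxBound n ξ ω) :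
    ∃ C : ℝ, 0 < C ∧ ∀ (T : ℤ[X]) (B : ℝ), T.natDegree ≤ n → T.supNorm ≤ B →
      |aeval ξ (derivative T)| ≤ C * |aeval ξ T| * B ^ (ω + 1) ∨
      |aeval ξ (derivative T)| ^ 2 ≤ C * |aeval ξ T| * B := by
  obtain ⟨c, hc, hb⟩ := h
  have hC := one_le_taylorConst n ξ
  have hg := one_le_gelfondConst n
  set C1 := 4 * ((n + 1) * taylorConst n ξ) with hC1
  set C2 := 2 * (gelfondConst n) ^ (ω + 1) / c with hC2
  have hC1pos : 0 < C1 := by positivity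
  have hC2pos : 0 < C2 := by positivity
  refine ⟨C1 + C2, by positivity, ?_⟩
  intro T B hdeg hB
  by_cases hD : aeval ξ (derivative T) = 0
  · left
    rw [hD, abs_zero]
    have : 0 ≤ B := T.supNorm_nonneg.trans hB
    positivity
  have hT0 : T ≠ 0 := by
    rintro rfl
    simp at hD
  have hB1 : 1 ≤ B := (one_le_supNorm hT0).trans hB
  by_cases hq : 4 * ((n + 1) * taylorConst n ξ * T.supNorm) * |aeval ξ T| ≤
      aeval ξ (derivative T) ^ 2
  · left
    obtain ⟨α, hα, hd⟩ := exists_real_root_near hdeg ξ hD hq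
    obtain ⟨A, hA, R, hR⟩ := exists_integerMinpoly_dvd hT0 hα
    have hA0 : A ≠ 0 := by rintro rfl; simp at hR; exact hT0 hR
    have hR0 : R ≠ 0 := by rintro rfl; simp at hR; exact hT0 hR
    have hAn : A.natDegree ≤ n := by
      rw [hR, natDegree_mul hA0 hR0] at hdeg; omega
    have h1 := hb α A hA hAn
    have hAB : A.supNorm ≤ gelfondConst n * B := by
      have h2 := supNorm_mul_supNorm_le hA0 hR0 (n := n) (by rwa [← hR])
      rw [← hR] at h2
      have h3 := one_le_supNorm hR0
      have h4 := A.supNorm_nonneg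
      calc A.supNorm ≤ A.supNorm * R.supNorm := le_mul_of_one_le_right h4 h3
        _ ≤ gelfondConst n * T.supNorm := h2
        _ ≤ _ := by gcongr
    have hApos : 0 < A.supNorm := lt_of_lt_of_le one_pos (one_le_supNorm hA0)
    have h5 : A.supNorm ^ (ω + 1) ≤ gelfondConst n ^ (ω + 1) * B ^ (ω + 1) := by
      rw [← Real.mul_rpow (by linarith) (by linarith)]
      exact Real.rpow_le_rpow hApos.le hAB (by linarith)
    have h6 : c ≤ 2 * |aeval ξ T| / |aeval ξ (derivative T)| * A.supNorm ^ (ω + 1) := by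
      have h7 := h1.trans hd
      rw [show -ω - 1 = -(ω + 1) by ring, Real.rpow_neg hApos.le, ← div_eq_mul_inv,
        div_le_iff₀ (by positivity)] at h7
      exact h7
    have hDpos : 0 < |aeval ξ (derivative T)| := abs_pos.mpr hD
    have h8 : c * |aeval ξ (derivative T)| ≤
        2 * |aeval ξ T| * (gelfondConst n ^ (ω + 1) * B ^ (ω + 1)) := by
      rw [div_mul_eq_mul_div, le_div_iff₀ hDpos] at h6
      exact h6.trans (by gcongr)
    have h9 : |aeval ξ (derivative T)| ≤ C2 * |aeval ξ T| * B ^ (ω + 1) := by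
      rw [hC2, div_mul_eq_mul_div, div_mul_eq_mul_div, le_div_iff₀ hc]
      linarith
    refine h9.trans ?_
    have : 0 ≤ B ^ (ω + 1) := by positivity
    gcongr
    linarith
  · right
    rw [sq_abs]
    push Not at hq
    refine hq.le.trans ?_
    have : 4 * ((n + 1) * taylorConst n ξ * T.supNorm) * |aeval ξ T| =
      C1 * |aeval ξ T| * T.supNorm := by rw [hC1]; ring
    rw [this]
    gcongr
    · exact T.supNorm_nonneg
    · linarith

/-! ### Spans of small integer polynomials -/

/-- An integer polynomial, viewed over `ℚ`. -/
noncomputable abbrev toRat (T : ℤ[X]) : ℚ[X] := T.map (Int.castRingHom ℚ)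

theorem aeval_toRat (T : ℤ[X]) (x : ℝ) : aeval x (toRat T) = aeval x T := by
  rw [toRat, aeval_def, eval₂_map, aeval_def]
  congr 1

theorem natDegree_toRat (T : ℤ[X]) : (toRat T).natDegree = T.natDegree :=
  natDegree_map_eq_of_injective (Int.cast_injective) T

/-- Integer polynomials of degree at most `n` and height at most `Y` whose value at `ξ` is at most
`δ`. -/
def smallPolys (n : ℕ) (ξ Y δ : ℝ) : Set ℤ[X] :=
  {T | T.natDegree ≤ n ∧ T.supNorm ≤ Y ∧ |aeval ξ T| ≤ δ}

/-- The rational span of a set of integer polynomials. -/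
noncomputable def ratSpan (S : Set ℤ[X]) : Submodule ℚ ℚ[X] := Submodule.span ℚ (toRat '' S)

theorem ratSpan_le_degreeLT {S : Set ℤ[X]} {n : ℕ} (h : ∀ T ∈ S, T.natDegree ≤ n) :
    ratSpan S ≤ degreeLT ℚ (n + 1) := by
  rw [ratSpan, Submodule.span_le]
  rintro _ ⟨T, hT, rfl⟩
  rw [SetLike.mem_coe, mem_degreeLT]
  refine lt_of_le_of_lt degree_le_natDegree ?_
  rw [natDegree_toRat]
  exact_mod_cast Nat.lt_succ_of_le (h T hT)

theorem finrank_degreeLT {F : Type*} [Field F] (n : ℕ) :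
    Module.finrank F (degreeLT F n) = n := by
  rw [(degreeLTEquiv F n).finrank_eq]; simp

theorem ApproxBound.le_of_mem_ratSpan {n : ℕ} {ξ ω : ℝ} (hω : 0 ≤ ω) (h : ApproxBound n ξ ω) :
    ∃ c : ℝ, 0 < c ∧ ∀ Y δ : ℝ, 1 ≤ Y → 1 ∈ ratSpan (smallPolys n ξ Y δ) →
      X ∈ ratSpan (smallPolys n ξ Y δ) → c * Y ^ (-ω) ≤ δ := by
  obtain ⟨K, hK, hder⟩ := h.derivative_bound hω
  have hτ := one_le_taylorConst n ξ
  set τ := taylorConst n ξ with hτdef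
  set D := (n + 1) * τ + 1 with hD
  have hDpos : 0 < D := by positivity
  set E := D * (1 + |ξ|) + (n + 1) with hE
  have hEpos : 1 ≤ E := by
    have : 0 ≤ D * (1 + |ξ|) := by positivity
    have : (0 : ℝ) ≤ n := by positivity
    linarith
  set c1 := 1 / (K * (n + 1) * E ^ (ω + 1)) with hc1
  set c2 := 1 / (K * (n + 1) * E) with hc2
  have hc1pos : 0 < c1 := by positivity
  have hc2pos : 0 < c2 := by positivity
  refine ⟨min c1 c2, lt_min hc1pos hc2pos, ?_⟩
  intro Y δ hY h1 hX
  set S := smallPolys n ξ Y δ with hS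
  have hle : ratSpan S ≤ degreeLT ℚ (n + 1) := ratSpan_le_degreeLT fun T hT => hT.1
  have : FiniteDimensional ℚ (ratSpan S) := Submodule.finiteDimensional_of_le hle
  have : Module.Finite ℚ (Submodule.span ℚ (toRat '' S)) := this
  obtain ⟨f, hf, hspan, -⟩ := Submodule.exists_fun_fin_finrank_span_eq ℚ (toRat '' S)
  have hN : Module.finrank ℚ (Submodule.span ℚ (toRat '' S)) ≤ n + 1 := by
    have := Submodule.finrank_mono hle
    rwa [finrank_degreeLT] at this
  generalize Module.finrank ℚ (Submodule.span ℚ (toRat '' S)) = N at f hf hspan hN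
  choose T hTS hTf using hf
  unfold ratSpan at h1 hX
  rw [← hspan, Submodule.mem_span_range_iff_exists_fun] at h1 hX
  obtain ⟨a, ha⟩ := h1
  obtain ⟨b, hb⟩ := hX
  set θ : Fin N → ℝ := fun i => D * Y * (b i - ξ * a i) with hθ
  set R : ℤ[X] := ∑ i, C (round (θ i)) * T i with hR
  have hround : ∀ i, |(round (θ i) : ℝ) - θ i| ≤ 1 := fun i => by
    rw [abs_sub_comm]; exact (abs_sub_round (θ i)).trans (by norm_num)
  -- linear functionals are controlled by their values on the `T i`
  have key : ∀ (L : ℚ[X] →ₗ[ℚ] ℝ) (B : ℝ), (∀ i, |L (toRat (T i))| ≤ B) → 0 ≤ B →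
      |L (toRat R) - D * Y * (L X - ξ * L 1)| ≤ (n + 1) * B := by
    intro L B hL hB
    have e1 : L (toRat R) = ∑ i, (round (θ i) : ℝ) * L (toRat (T i)) := by
      rw [hR, toRat, Polynomial.map_sum, map_sum]
      refine Finset.sum_congr rfl fun i _ => ?_
      rw [Polynomial.map_mul, map_C, ← smul_eq_C_mul, map_smul, Rat.smul_def]
      simp
    have e2 : D * Y * (L X - ξ * L 1) = ∑ i, θ i * L (toRat (T i)) := by
      rw [← ha, ← hb, map_sum, map_sum, Finset.mul_sum, ← Finset.sum_sub_distrib, Finset.mul_sum]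
      refine Finset.sum_congr rfl fun i _ => ?_
      rw [map_smul, map_smul, Rat.smul_def, Rat.smul_def, hTf i, hθ]
      ring
    rw [e1, e2, ← Finset.sum_sub_distrib]
    refine (Finset.abs_sum_le_sum_abs _ _).trans ?_
    have : ∀ i ∈ Finset.univ, |(round (θ i) : ℝ) * L (toRat (T i)) - θ i * L (toRat (T i))| ≤ B := by
      intro i _
      rw [← sub_mul, abs_mul]
      calc _ ≤ 1 * B := by gcongr; exacts [hround i, hL i]
        _ = B := one_mul B
    refine (Finset.sum_le_card_nsmul _ _ _ this).trans ?_
    rw [Finset.card_univ, Fintype.card_fin, nsmul_eq_mul]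
    gcongr
    exact_mod_cast hN
  have hδ : 0 ≤ δ ∨ N = 0 := by
    rcases Nat.eq_zero_or_pos N with h0 | h0
    · exact Or.inr h0
    · exact Or.inl ((abs_nonneg _).trans (hTS ⟨0, h0⟩).2.2)
  have hN0 : N ≠ 0 := by
    rintro rfl
    simp at ha
  have hδ0 : 0 ≤ δ := hδ.resolve_right hN0
  have hRdeg : R.natDegree ≤ n := by
    rw [hR]
    refine natDegree_sum_le_of_forall_le _ _ fun i _ => ?_
    exact (natDegree_C_mul_le _ _).trans (hTS i).1
  have hRval : |aeval ξ R| ≤ (n + 1) * δ := by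
    have := key (aeval ξ).toLinearMap δ (fun i => by
      rw [AlgHom.toLinearMap_apply, aeval_toRat]; exact (hTS i).2.2) hδ0
    rw [AlgHom.toLinearMap_apply, AlgHom.toLinearMap_apply, AlgHom.toLinearMap_apply, aeval_toRat,
      aeval_X, map_one, mul_one, sub_self, mul_zero, sub_zero] at this
    exact this
  have hRder : Y ≤ |aeval ξ (derivative R)| := by
    have := key ((aeval ξ).toLinearMap ∘ₗ derivative) (τ * Y) (fun i => by
      rw [LinearMap.comp_apply, AlgHom.toLinearMap_apply, derivative_map, aeval_toRat]
      exact (abs_aeval_derivative_le (hTS i).1 ξ).trans (by gcongr; exact (hTS i).2.1))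
      (by positivity)
    simp only [LinearMap.comp_apply, AlgHom.toLinearMap_apply, derivative_map, aeval_toRat,
      derivative_X, derivative_one, map_one, map_zero, mul_zero, sub_zero, mul_one] at this
    have h2 := (abs_le.mp this).1
    have h3 : D * Y = (n + 1) * (τ * Y) + Y := by rw [hD]; ring
    exact (by linarith : Y ≤ aeval ξ (derivative R)).trans (le_abs_self _)
  have hRnorm : R.supNorm ≤ E * Y := by
    apply supNorm_le_of_coeff
    intro j
    have := key ((Algebra.linearMap ℚ ℝ) ∘ₗ lcoeff ℚ j) Y (fun i => by
      simpa using (abs_coeff_le_supNorm (T i) j).trans (hTS i).2.1) (by positivity)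
    simp only [LinearMap.comp_apply, lcoeff_apply, Algebra.linearMap_apply, coeff_map] at this
    simp only [eq_intCast, eq_ratCast, Rat.cast_intCast] at this
    have h4 : |((X : ℚ[X]).coeff j : ℝ) - ξ * ((1 : ℚ[X]).coeff j : ℝ)| ≤ 1 + |ξ| := by
      have hx : |((X : ℚ[X]).coeff j : ℝ)| ≤ 1 := by rw [coeff_X]; split_ifs <;> simp
      have hy : |((1 : ℚ[X]).coeff j : ℝ)| ≤ 1 := by rw [coeff_one]; split_ifs <;> simp
      refine (abs_sub _ _).trans (add_le_add hx ?_)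
      rw [abs_mul]
      exact mul_le_of_le_one_right (abs_nonneg ξ) hy
    have h5 : |D * Y * (((X : ℚ[X]).coeff j : ℝ) - ξ * ((1 : ℚ[X]).coeff j : ℝ))| ≤
        D * Y * (1 + |ξ|) := by
      rw [abs_mul, abs_of_nonneg (by positivity : 0 ≤ D * Y)]
      gcongr
    have h6 := abs_le.mp this
    have h7 := abs_le.mp h5
    rw [abs_le, hE]
    constructor <;> nlinarith [h6.1, h6.2, h7.1, h7.2]
  rcases hder R (E * Y) hRdeg hRnorm with h6 | h6
  · have h7 : Y ≤ K * ((n + 1) * δ) * (E * Y) ^ (ω + 1) :=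
      (hRder.trans h6).trans (by gcongr)
    rw [Real.mul_rpow (by linarith) (by linarith), Real.rpow_add_one (by linarith : Y ≠ 0)] at h7
    have h8 : 1 ≤ K * (n + 1) * E ^ (ω + 1) * (δ * Y ^ ω) := by
      have h9 : 1 * Y ≤ (K * (n + 1) * E ^ (ω + 1) * (δ * Y ^ ω)) * Y := by linarith
      exact le_of_mul_le_mul_right h9 (by linarith)
    have h10 : c1 ≤ δ * Y ^ ω := by
      rw [hc1, div_le_iff₀ (by positivity)]; linarith
    rw [Real.rpow_neg (by linarith), ← div_eq_mul_inv, div_le_iff₀ (by positivity)]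
    exact (min_le_left _ _).trans h10
  · have h7 : Y * Y ≤ K * ((n + 1) * δ) * (E * Y) := by
      calc Y * Y ≤ |aeval ξ (derivative R)| ^ 2 := by rw [sq]; gcongr
        _ ≤ _ := h6
        _ ≤ _ := by gcongr
    have h8 : Y ≤ K * (n + 1) * E * δ := by
      have h9 : Y * Y ≤ (K * (n + 1) * E * δ) * Y := by linarith
      exact le_of_mul_le_mul_right h9 (by linarith)
    have h10 : c2 * Y ≤ δ := by
      rw [hc2, div_mul_eq_mul_div, one_mul, div_le_iff₀ (by positivity)]; linarith
    calc min c1 c2 * Y ^ (-ω) ≤ c2 * Y := by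
          gcongr
          · exact min_le_right _ _
          · exact (Real.rpow_le_one_of_one_le_of_nonpos hY (by linarith)).trans hY
      _ ≤ δ := h10

/-! ### Counting small integer polynomials -/

theorem natDegree_le_of_mem_degreeLT {R : Type*} [Semiring R] {T : R[X]} {k : ℕ}
    (h : T ∈ degreeLT R (k + 1)) : T.natDegree ≤ k := by
  rw [mem_degreeLT, degree_lt_iff_coeff_zero] at h
  exact natDegree_le_iff_coeff_eq_zero.mpr fun i hi => h i hi

theorem finite_smallPolys (n : ℕ) (ξ Y δ : ℝ) : (smallPolys n ξ Y δ).Finite :=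
  (finite_supNorm_le n Y).subset fun _ h => ⟨h.1, h.2.1⟩

theorem exists_le_ncard_smallPolys (k : ℕ) (ξ : ℝ) :
    ∃ c : ℝ, 0 < c ∧ ∀ Y δ : ℝ, 1 ≤ Y → 0 < δ → δ ≤ Y →
      c * (Y ^ k * δ) ≤ (smallPolys k ξ Y δ).ncard := by
  set τ := taylorConst k ξ with hτdef
  have hτ : 1 ≤ τ := one_le_taylorConst k ξ
  refine ⟨1 / (2 * τ + 3), by positivity, ?_⟩
  intro Y δ hY hδ hδY
  set B := ⌊Y⌋₊ with hB
  set m := ⌈τ * Y / δ⌉₊ with hm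
  let p : (Fin (k + 1) → Fin (B + 1)) → ℤ[X] := fun a => ofFn (k + 1) fun i => ((a i : ℕ) : ℤ)
  have hpc : ∀ a (i : Fin (k + 1)), (p a).coeff i = ((a i : ℕ) : ℤ) := fun a i =>
    ofFn_coeff_eq_val_of_lt _ i.2
  have hpd : ∀ a, (p a).natDegree ≤ k := fun a =>
    Nat.lt_succ_iff.mp (ofFn_natDegree_lt (by omega) _)
  have hpB : ∀ a i, 0 ≤ (p a).coeff i ∧ (p a).coeff i ≤ B := by
    intro a i
    by_cases hi : i < k + 1
    · have := hpc a ⟨i, hi⟩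
      simp only at this
      rw [this]
      have := (a ⟨i, hi⟩).2
      omega
    · rw [coeff_eq_zero_of_natDegree_lt (lt_of_le_of_lt (hpd a) (by omega))]
      omega
  have hpinj : Function.Injective p := by
    intro a a' h
    funext i
    have h1 := hpc a i
    rw [h, hpc a' i] at h1
    exact Fin.ext (by exact_mod_cast h1.symm)
  have hBY : (B : ℝ) ≤ Y := Nat.floor_le (by linarith)
  have hval : ∀ a, |aeval ξ (p a)| ≤ τ * Y := by
    intro a
    refine (abs_aeval_le (hpd a) ξ).trans ?_
    gcongr
    apply supNorm_le_of_coeff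
    intro i
    rw [abs_of_nonneg (by exact_mod_cast (hpB a i).1)]
    refine le_trans ?_ hBY
    exact_mod_cast (hpB a i).2
  let box : (Fin (k + 1) → Fin (B + 1)) → ℤ := fun a => ⌊aeval ξ (p a) / δ⌋
  have hmaps : ∀ a ∈ (Finset.univ : Finset (Fin (k + 1) → Fin (B + 1))),
      box a ∈ Finset.Icc (-(m : ℤ)) m := by
    intro a _
    have h1 := abs_le.mp (hval a)
    have h2 : τ * Y / δ ≤ m := Nat.le_ceil _
    rw [div_le_iff₀ hδ] at h2
    rw [Finset.mem_Icc]
    constructor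
    · rw [Int.le_floor, le_div_iff₀ hδ]
      push_cast
      linarith [h1.1]
    · have : ((⌊aeval ξ (p a) / δ⌋ : ℤ) : ℝ) ≤ (m : ℝ) := by
        refine (Int.floor_le _).trans ?_
        rw [div_le_iff₀ hδ]
        linarith [h1.2]
      exact_mod_cast this
  have hcard : (Finset.Icc (-(m : ℤ)) m).card = 2 * m + 1 := by
    rw [Int.card_Icc]; omega
  obtain ⟨y, -, hy⟩ := Finset.exists_le_card_fiber_of_nsmul_le_card_of_maps_to
    (b := ((B : ℝ) + 1) ^ (k + 1) / (2 * m + 1)) hmaps ⟨0, by simp⟩ (by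
      rw [hcard, nsmul_eq_mul, Finset.card_univ, Fintype.card_fun, Fintype.card_fin,
        Fintype.card_fin]
      push_cast
      rw [mul_div_cancel₀ _ (by positivity)])
  set F := Finset.univ.filter fun a => box a = y with hF
  have hFpos : (0 : ℝ) < F.card := lt_of_lt_of_le (by positivity) hy
  obtain ⟨a0, ha0⟩ : F.Nonempty := Finset.card_pos.mp (by exact_mod_cast hFpos)
  have hsub : F.card ≤ (smallPolys k ξ Y δ).ncard := by
    rw [← Set.ncard_coe_finset]
    refine Set.ncard_le_ncard_of_injOn (fun a => p a - p a0) ?_ ?_ (finite_smallPolys k ξ Y δ)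
    · intro a ha
      have ha' : box a = y := by simpa [hF] using ha
      have ha0' : box a0 = y := by simpa [hF] using ha0
      refine ⟨(natDegree_sub_le _ _).trans (max_le (hpd a) (hpd a0)), ?_, ?_⟩
      · apply supNorm_le_of_coeff
        intro i
        have h1 := hpB a i
        have h2 := hpB a0 i
        refine le_trans ?_ hBY
        rw [coeff_sub]
        have : |(p a).coeff i - (p a0).coeff i| ≤ (B : ℤ) := by rw [abs_le]; omega
        exact_mod_cast this
      · have h3 : |aeval ξ (p a) / δ - aeval ξ (p a0) / δ| < 1 :=
          Int.abs_sub_lt_one_of_floor_eq_floor (ha'.trans ha0'.symm)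
        rw [← sub_div, abs_div, abs_of_pos hδ, div_lt_one hδ] at h3
        rw [map_sub]
        exact h3.le
    · intro a _ a' _ h
      exact hpinj (sub_left_injective h)
  have h1 : (F.card : ℝ) ≤ (smallPolys k ξ Y δ).ncard := by exact_mod_cast hsub
  refine le_trans ?_ (hy.trans h1)
  have h2 : Y ≤ B + 1 := (Nat.lt_floor_add_one Y).le
  have h3 : (2 * m + 1 : ℝ) ≤ (2 * τ + 3) * Y / δ := by
    have h4 : (m : ℝ) ≤ τ * Y / δ + 1 := (Nat.ceil_lt_add_one (by positivity)).le
    have h5 : 1 ≤ Y / δ := by rwa [one_le_div hδ]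
    calc (2 * m + 1 : ℝ) ≤ 2 * (τ * Y / δ) + 3 * (Y / δ) := by linarith
      _ = _ := by ring
  rw [le_div_iff₀ (by positivity)]
  calc 1 / (2 * τ + 3) * (Y ^ k * δ) * (2 * m + 1)
      ≤ 1 / (2 * τ + 3) * (Y ^ k * δ) * ((2 * τ + 3) * Y / δ) := by gcongr
    _ = Y ^ (k + 1) := by rw [pow_succ]; field_simp
    _ ≤ _ := by gcongr

/-- **Dirichlet's theorem** for linear forms in the powers of `ξ`. -/
theorem exists_dirichlet (k : ℕ) (ξ : ℝ) :
    ∃ C : ℝ, 0 < C ∧ ∀ Y : ℝ, 1 ≤ Y → ∃ T : ℤ[X], T ≠ 0 ∧ T.natDegree ≤ k ∧ T.supNorm ≤ Y ∧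
      |aeval ξ T| ≤ C / Y ^ k := by
  obtain ⟨c, hc, h⟩ := exists_le_ncard_smallPolys k ξ
  refine ⟨2 / c, by positivity, fun Y hY => ?_⟩
  set δ := 2 / c / Y ^ k with hδ
  have hδpos : 0 < δ := by positivity
  rcases le_total 1 δ with h1 | h1
  · refine ⟨1, one_ne_zero, by simp, ?_, by simpa using h1⟩
    rw [← map_one C, supNorm_C]
    simpa using hY
  · have h2 := h Y δ hY hδpos (h1.trans hY)
    have h3 : c * (Y ^ k * δ) = 2 := by rw [hδ]; field_simp
    rw [h3] at h2
    have h4 : 1 < (smallPolys k ξ Y δ).ncard := by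
      have : (2 : ℝ) ≤ _ := h2
      exact_mod_cast this
    obtain ⟨T, hT, hT0⟩ := Set.exists_ne_of_one_lt_ncard h4 0
    exact ⟨T, hT0, hT.1, hT.2.1, hT.2.2⟩

theorem supNorm_intCast_mul (M : ℕ) (T : ℤ[X]) :
    ((M : ℤ) • T).supNorm = M * T.supNorm := by
  apply le_antisymm
  · apply supNorm_le_of_coeff
    intro i
    rw [coeff_smul, smul_eq_mul]
    push_cast
    rw [abs_mul, Nat.abs_cast]
    gcongr
    exact abs_coeff_le_supNorm T i
  · obtain ⟨i, hi⟩ := T.exists_eq_supNorm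
    have := abs_coeff_le_supNorm ((M : ℤ) • T) i
    rw [coeff_smul, smul_eq_mul] at this
    push_cast at this
    rw [abs_mul, Nat.abs_cast] at this
    rwa [hi, Int.norm_eq_abs]

/-- A packing bound: when there is no nonzero polynomial with height at most `B` and value less
than `ε`, the number of polynomials in a dilated region is controlled by the dimension of their
span. -/
theorem ncard_smallPolys_le (k : ℕ) (ξ B ε Y δ : ℝ) (M : ℕ)
    (hmin : ∀ T : ℤ[X], T ≠ 0 → T.natDegree ≤ k → T.supNorm ≤ B → ε ≤ |aeval ξ T|)
    (hM : 0 < M) (hY : 2 * Y ≤ M * B) (hδ : 2 * δ < M * ε) :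
    (smallPolys k ξ Y δ).ncard ≤ M ^ Module.finrank ℚ (ratSpan (smallPolys k ξ Y δ)) := by
  set S := smallPolys k ξ Y δ with hS
  set Λ : Submodule ℤ ℤ[X] := Submodule.span ℤ S with hΛ
  have : Module.Finite ℤ Λ := Module.Finite.span_of_finite ℤ (finite_smallPolys k ξ Y δ)
  have : Module.Free ℤ Λ := Module.free_of_finite_type_torsion_free'
  let b := Module.finBasis ℤ Λ
  have hle : ratSpan S ≤ degreeLT ℚ (k + 1) := ratSpan_le_degreeLT fun T hT => hT.1
  have : FiniteDimensional ℚ (ratSpan S) := Submodule.finiteDimensional_of_le hle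
  have hΛdeg : ∀ T ∈ Λ, T.natDegree ≤ k := by
    have : Λ ≤ degreeLT ℤ (k + 1) := by
      rw [hΛ, Submodule.span_le]
      intro T hT
      rw [SetLike.mem_coe, mem_degreeLT]
      exact lt_of_le_of_lt degree_le_natDegree (by exact_mod_cast Nat.lt_succ_of_le hT.1)
    exact fun T hT => natDegree_le_of_mem_degreeLT (this hT)
  let φ : ℤ[X] →ₗ[ℤ] ℚ[X] := (mapRingHom (Int.castRingHom ℚ)).toAddMonoidHom.toIntLinearMap
  have hφ : ∀ T, φ T = toRat T := fun T => rfl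
  have hφinj : Function.Injective φ := map_injective _ Int.cast_injective
  have hΛspan : ∀ T ∈ Λ, toRat T ∈ ratSpan S := by
    intro T hT
    have : Λ ≤ ((ratSpan S).restrictScalars ℤ).comap φ := by
      rw [hΛ, Submodule.span_le]
      intro T hT
      exact Submodule.subset_span ⟨T, hT, rfl⟩
    exact this hT
  have hrank : Module.finrank ℤ Λ ≤ Module.finrank ℚ (ratSpan S) := by
    have h1 : LinearIndependent ℤ fun i => φ (b i : ℤ[X]) := by
      have h2 : LinearIndependent ℤ fun i => (b i : ℤ[X]) :=
        b.linearIndependent.map' Λ.subtype (Submodule.ker_subtype Λ)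
      exact h2.map' φ (LinearMap.ker_eq_bot.mpr hφinj)
    have h3 : LinearIndependent ℚ fun i => φ (b i : ℤ[X]) :=
      (LinearIndependent.iff_fractionRing ℤ ℚ).mp h1
    have h4 : LinearIndependent ℚ fun i : Fin (Module.finrank ℤ Λ) =>
        (⟨φ (b i : ℤ[X]), hΛspan _ (b i).2⟩ : ratSpan S) := by
      refine LinearIndependent.of_comp (ratSpan S).subtype ?_
      exact h3
    simpa using h4.fintype_card_le_finrank
  have : NeZero M := ⟨hM.ne'⟩
  have hmem : ∀ T : S, (T : ℤ[X]) ∈ Λ := fun T => Submodule.subset_span T.2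
  let g : S → (Fin (Module.finrank ℤ Λ) → ZMod M) := fun T i =>
    ((b.repr ⟨T, hmem T⟩ i : ℤ) : ZMod M)
  have hginj : Function.Injective g := by
    intro T T' h
    have h1 : ∀ i, ∃ z : ℤ, b.repr ⟨T, hmem T⟩ i - b.repr ⟨T', hmem T'⟩ i = M * z := by
      intro i
      have h2 := congrFun h i
      simp only [g] at h2
      rw [ZMod.intCast_eq_intCast_iff_dvd_sub] at h2
      obtain ⟨z, hz⟩ := h2
      exact ⟨-z, by linarith⟩
    choose z hz using h1
    set v : Λ := ∑ i, z i • b i with hv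
    have h3 : (⟨T, hmem T⟩ - ⟨T', hmem T'⟩ : Λ) = (M : ℤ) • v := by
      apply b.repr.injective
      ext i
      rw [map_sub, Finsupp.sub_apply, hz i, hv, map_smul, Finsupp.smul_apply,
        b.repr_sum_self, smul_eq_mul]
    have h4 : (T : ℤ[X]) - T' = (M : ℤ) • (v : ℤ[X]) := by
      have := congrArg Subtype.val h3
      simpa using this
    have hMpos : (0 : ℝ) < M := by exact_mod_cast hM
    by_contra hne
    have hv0 : (v : ℤ[X]) ≠ 0 := by
      intro h0
      rw [h0, smul_zero, sub_eq_zero] at h4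
      exact hne (Subtype.ext h4)
    have h5 : (M : ℝ) * (v : ℤ[X]).supNorm ≤ M * B := by
      rw [← supNorm_intCast_mul, ← h4]
      refine le_trans ?_ hY
      apply supNorm_le_of_coeff
      intro i
      rw [coeff_sub]
      push_cast
      have e1 := (abs_coeff_le_supNorm (T : ℤ[X]) i).trans T.2.2.1
      have e2 := (abs_coeff_le_supNorm (T' : ℤ[X]) i).trans T'.2.2.1
      exact (abs_sub _ _).trans (by linarith)
    have h6 := hmin v hv0 (hΛdeg _ v.2) (le_of_mul_le_mul_left h5 hMpos)
    have h7 : (M : ℝ) * |aeval ξ (v : ℤ[X])| ≤ 2 * δ := by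
      have : aeval ξ ((M : ℤ) • (v : ℤ[X])) = M * aeval ξ (v : ℤ[X]) := by
        rw [map_zsmul, zsmul_eq_mul]; simp
      rw [← Nat.abs_cast, ← abs_mul, ← this, ← h4, map_sub]
      exact (abs_sub _ _).trans (by linarith [T.2.2.2, T'.2.2.2])
    have h8 : (M : ℝ) * ε ≤ M * |aeval ξ (v : ℤ[X])| := by gcongr
    linarith
  have hcard : S.ncard ≤ M ^ Module.finrank ℤ Λ := by
    have : Finite S := finite_smallPolys k ξ Y δ
    rw [← Nat.card_coe_set_eq]
    refine (Nat.card_le_card_of_injective g hginj).trans (le_of_eq ?_)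
    simp [Nat.card_eq_fintype_card, ZMod.card]
  exact hcard.trans (Nat.pow_le_pow_right hM hrank)

/-! ### A determinant estimate and the resultant of two polynomials small at `ξ` -/

theorem abs_det_le_of_shifted {N : ℕ} (hN : 3 ≤ N) (M : Matrix (Fin N) (Fin N) ℝ) (s : Fin N → ℕ)
    {A ε D : ℝ} (hε : 0 ≤ ε) (hεD : ε ≤ D) (hA : ∀ i j, |M i j| ≤ A)
    (h0 : ∀ (i : Fin N) j, (i : ℕ) < s j → M i j = 0) (h1 : ∀ (i : Fin N) j, (i : ℕ) = s j → |M i j| ≤ ε)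
    (h2 : ∀ (i : Fin N) j, (i : ℕ) = s j + 1 → |M i j| ≤ D)
    (hs : ∀ a b c, a ≠ b → a ≠ c → b ≠ c → s a = 0 → s b = 0 → s c ≠ 0) :
    |M.det| ≤ N.factorial * (A ^ (N - 3) * (ε ^ 2 * A + ε * D ^ 2)) := by
  obtain ⟨n, rfl⟩ : ∃ n, N = n + 3 := ⟨N - 3, by omega⟩
  have hA0 : 0 ≤ A := (abs_nonneg _).trans (hA 0 0)
  have hD : 0 ≤ D := hε.trans hεD
  rw [← Matrix.det_transpose, Matrix.det_apply']
  refine (Finset.abs_sum_le_sum_abs _ _).trans ?_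
  have key : ∀ σ ∈ (Finset.univ : Finset (Equiv.Perm (Fin (n + 3)))),
      |((Equiv.Perm.sign σ : ℤ) : ℝ) * ∏ i, M.transpose (σ i) i| ≤
        A ^ (n + 3 - 3) * (ε ^ 2 * A + ε * D ^ 2) := by
    intro σ _
    have hsign : |((Equiv.Perm.sign σ : ℤ) : ℝ)| = 1 := by
      rcases Int.units_eq_one_or (Equiv.Perm.sign σ) with h | h <;> rw [h] <;> simp
    rw [abs_mul, hsign, one_mul, Finset.abs_prod]
    simp only [Matrix.transpose_apply]
    rw [Fin.prod_univ_succ, Fin.prod_univ_succ, Fin.prod_univ_succ]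
    set c0 := σ 0 with hc0
    set c1 := σ (Fin.succ 0) with hc1
    set c2 := σ (Fin.succ (Fin.succ 0)) with hc2
    have h01 : c0 ≠ c1 := fun h => by simpa using σ.injective h
    have h02 : c0 ≠ c2 := fun h => absurd (congrArg Fin.val (σ.injective h)) (Nat.zero_ne_add_one 1)
    have h12 : c1 ≠ c2 := fun h =>
      absurd (congrArg Fin.val (σ.injective h)) (Nat.succ_ne_succ_iff.mpr (Nat.zero_ne_add_one 0))
    have v2 : ((Fin.succ (Fin.succ 0) : Fin (n + 3)) : ℕ) = 2 := rfl
    have hrest : ∏ i : Fin n, |M i.succ.succ.succ (σ i.succ.succ.succ)| ≤ A ^ n := by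
      refine (Finset.prod_le_prod (fun _ _ => abs_nonneg _) fun i _ => hA _ _).trans ?_
      simp
    have h3 : |M 0 c0| * (|M (Fin.succ 0) c1| * |M (Fin.succ (Fin.succ 0)) c2|) ≤
        ε ^ 2 * A + ε * D ^ 2 := by
      have hpos : 0 ≤ ε ^ 2 * A + ε * D ^ 2 := by positivity
      have hposl : 0 ≤ ε ^ 2 * A := by positivity
      have hposr : 0 ≤ ε * D ^ 2 := by positivity
      by_cases e0 : s c0 = 0
      swap
      · rw [h0 0 c0 (Nat.pos_of_ne_zero e0)]
        simpa using hpos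
      have b0 := h1 0 c0 (by simp [e0])
      by_cases e1 : s c1 = 0
      · have b1 := h2 (Fin.succ 0) c1 (by simp [e1])
        have e2 := hs c0 c1 c2 h01 h02 h12 e0 e1
        have b2 : |M (Fin.succ (Fin.succ 0)) c2| ≤ D := by
          rcases Nat.lt_or_ge 2 (s c2) with h | h
          · rw [h0 _ c2 (by rw [v2]; exact h)]
            simpa using hD
          · rcases (by omega : s c2 = 2 ∨ s c2 = 1) with h | h
            · exact (h1 _ c2 (by rw [v2, h])).trans hεD
            · exact h2 _ c2 (by rw [v2, h])
        calc _ ≤ ε * (D * D) := by gcongr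
          _ ≤ _ := by nlinarith
      · by_cases e1' : s c1 = 1
        · have b1 := h1 (Fin.succ 0) c1 (by simp [e1'])
          calc _ ≤ ε * (ε * A) := by
                gcongr
                exact hA _ _
            _ ≤ _ := by nlinarith
        · rw [h0 (Fin.succ 0) c1 (by simp; omega)]
          simpa using hpos
    have e : |M 0 c0| * (|M (Fin.succ 0) c1| * (|M (Fin.succ (Fin.succ 0)) c2| *
        ∏ i : Fin n, |M i.succ.succ.succ (σ i.succ.succ.succ)|)) =
        (∏ i : Fin n, |M i.succ.succ.succ (σ i.succ.succ.succ)|) *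
        (|M 0 c0| * (|M (Fin.succ 0) c1| * |M (Fin.succ (Fin.succ 0)) c2|)) := by ring
    rw [e, Nat.add_sub_cancel]
    gcongr
  refine (Finset.sum_le_card_nsmul _ _ _ key).trans (le_of_eq ?_)
  rw [Finset.card_univ, Fintype.card_perm, Fintype.card_fin, nsmul_eq_mul]

theorem one_le_abs_resultant_taylor {P Q : ℤ[X]} (hPQ : IsCoprime (toRat P) (toRat Q)) (hQ : Q ≠ 0)
    (ξ : ℝ) {k : ℕ} (hk : P.natDegree ≤ k) :
    1 ≤ |resultant (taylor ξ (P.map (Int.castRingHom ℝ))) (taylor ξ (Q.map (Int.castRingHom ℝ)))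
      k Q.natDegree| := by
  set f := P.map (Int.castRingHom ℝ)
  set g := Q.map (Int.castRingHom ℝ)
  have hf : f.natDegree = P.natDegree := natDegree_map_eq_of_injective Int.cast_injective P
  have hg : g.natDegree = Q.natDegree := natDegree_map_eq_of_injective Int.cast_injective Q
  have hres : resultant P Q ≠ 0 := by
    have h := resultant_ne_zero _ _ hPQ
    rw [natDegree_toRat, natDegree_toRat, resultant_map_map] at h
    intro h0
    rw [h0] at h
    simp at h
  have h1 : resultant (taylor ξ f) (taylor ξ g) P.natDegree Q.natDegree =
      ((resultant P Q : ℤ) : ℝ) := by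
    have h := resultant_taylor f g ξ
    rw [natDegree_taylor, natDegree_taylor, hf, hg] at h
    rw [h, resultant_map_map]
    rfl
  have h2 : (taylor ξ g).coeff Q.natDegree = (Q.leadingCoeff : ℝ) := by
    rw [← hg, ← natDegree_taylor g ξ, coeff_natDegree, leadingCoeff_taylor, leadingCoeff,
      hg, coeff_map]
    rfl
  obtain ⟨j, rfl⟩ := Nat.exists_eq_add_of_le hk
  rw [resultant_add_left_deg _ _ _ _ _ (by rw [natDegree_taylor, hf]), h1, h2, abs_mul, abs_mul,
    abs_pow, abs_pow, abs_neg, abs_one, one_pow, one_mul]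
  have h3 : (1 : ℝ) ≤ |(Q.leadingCoeff : ℝ)| := by
    exact_mod_cast Int.one_le_abs (leadingCoeff_ne_zero.mpr hQ)
  have h4 : (1 : ℝ) ≤ |((resultant P Q : ℤ) : ℝ)| := by exact_mod_cast Int.one_le_abs hres
  exact one_le_mul_of_one_le_of_one_le (one_le_pow₀ h3) h4

theorem one_le_of_isCoprime {k : ℕ} (hk : 3 ≤ k) (ξ : ℝ) :
    ∃ K : ℝ, 0 < K ∧ ∀ (P Q : ℤ[X]) (B ε D : ℝ), IsCoprime (toRat P) (toRat Q) → Q ≠ 0 →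
      P.natDegree ≤ k → Q.natDegree ≤ k → 1 ≤ B → P.supNorm ≤ B → Q.supNorm ≤ B →
      |aeval ξ P| ≤ ε → |aeval ξ Q| ≤ ε → |aeval ξ (derivative P)| ≤ D →
      |aeval ξ (derivative Q)| ≤ D → ε ≤ D →
      1 ≤ K * (B ^ (2 * k - 3) * (ε ^ 2 * B + ε * D ^ 2)) := by
  set τ := taylorConst k ξ with hτdef
  have hτ : 1 ≤ τ := one_le_taylorConst k ξ
  refine ⟨(2 * k).factorial * τ ^ (2 * k), by positivity, ?_⟩
  intro P Q B ε D hPQ hQ0 hPk hQk hB hPB hQB hPε hQε hPD hQD hεD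
  have hε : 0 ≤ ε := (abs_nonneg _).trans hPε
  have hD : 0 ≤ D := hε.trans hεD
  have hres := one_le_abs_resultant_taylor hPQ hQ0 ξ hPk
  set f := taylor ξ (P.map (Int.castRingHom ℝ)) with hf
  set g := taylor ξ (Q.map (Int.castRingHom ℝ)) with hg
  set r := Q.natDegree with hr
  have hfA : ∀ i, |f.coeff i| ≤ τ * B := fun i =>
    (abs_taylor_coeff_le hPk ξ i).trans (by gcongr)
  have hgA : ∀ i, |g.coeff i| ≤ τ * B := fun i =>
    (abs_taylor_coeff_le hQk ξ i).trans (by gcongr)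
  have hf0 : |f.coeff 0| ≤ ε := by rw [hf, taylor_coeff_zero_eq_aeval]; exact hPε
  have hg0 : |g.coeff 0| ≤ ε := by rw [hg, taylor_coeff_zero_eq_aeval]; exact hQε
  have hf1 : |f.coeff 1| ≤ D := by rw [hf, taylor_coeff_one_eq_aeval]; exact hPD
  have hg1 : |g.coeff 1| ≤ D := by rw [hg, taylor_coeff_one_eq_aeval]; exact hQD
  let s : Fin (k + r) → ℕ := fun j => j.addCases (fun a => (a : ℕ)) (fun a => (a : ℕ))
  have hdet := abs_det_le_of_shifted (N := k + r) (by omega) (sylvester f g k r) s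
    (A := τ * B) hε hεD ?_ ?_ ?_ ?_ ?_
  · refine hres.trans (hdet.trans ?_)
    have e1 : ((k + r).factorial : ℝ) ≤ (2 * k).factorial := by
      exact_mod_cast Nat.factorial_le (by omega)
    have hτB : 1 ≤ τ * B := one_le_mul_of_one_le_of_one_le hτ hB
    have e2 : (τ * B) ^ (k + r - 3) ≤ (τ * B) ^ (2 * k - 3) :=
      pow_le_pow_right₀ hτB (by omega)
    have e3 : τ ^ (2 * k - 3) * τ ≤ τ ^ (2 * k) := by
      rw [← pow_succ]
      exact pow_le_pow_right₀ hτ (by omega)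
    have e4 : ε ^ 2 * (τ * B) + ε * D ^ 2 ≤ τ * (ε ^ 2 * B + ε * D ^ 2) := by
      have : ε * D ^ 2 ≤ τ * (ε * D ^ 2) := le_mul_of_one_le_left (by positivity) hτ
      linarith
    calc ((k + r).factorial : ℝ) * ((τ * B) ^ (k + r - 3) * (ε ^ 2 * (τ * B) + ε * D ^ 2))
        ≤ (2 * k).factorial * ((τ * B) ^ (2 * k - 3) * (τ * (ε ^ 2 * B + ε * D ^ 2))) := by
          gcongr
      _ = (2 * k).factorial * (τ ^ (2 * k - 3) * τ) * (B ^ (2 * k - 3) *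
            (ε ^ 2 * B + ε * D ^ 2)) := by rw [mul_pow]; ring
      _ ≤ _ := by gcongr
  · intro i j
    induction j using Fin.addCases with
    | left a =>
      simp only [sylvester, Matrix.of_apply, Fin.addCases_left]
      split_ifs
      · exact hgA _
      · simp; positivity
    | right a =>
      simp only [sylvester, Matrix.of_apply, Fin.addCases_right]
      split_ifs
      · exact hfA _
      · simp; positivity
  · intro i j hij
    induction j using Fin.addCases with
    | left a =>
      simp only [s, Fin.addCases_left] at hij
      simp only [sylvester, Matrix.of_apply, Fin.addCases_left]
      rw [if_neg]
      rintro ⟨h, -⟩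
      omega
    | right a =>
      simp only [s, Fin.addCases_right] at hij
      simp only [sylvester, Matrix.of_apply, Fin.addCases_right]
      rw [if_neg]
      rintro ⟨h, -⟩
      omega
  · intro i j hij
    induction j using Fin.addCases with
    | left a =>
      simp only [s, Fin.addCases_left] at hij
      simp only [sylvester, Matrix.of_apply, Fin.addCases_left, hij, Nat.sub_self]
      split_ifs
      · exact hg0
      · simpa using hε
    | right a =>
      simp only [s, Fin.addCases_right] at hij
      simp only [sylvester, Matrix.of_apply, Fin.addCases_right, hij, Nat.sub_self]
      split_ifs
      · exact hf0
      · simpa using hε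
  · intro i j hij
    induction j using Fin.addCases with
    | left a =>
      simp only [s, Fin.addCases_left] at hij
      simp only [sylvester, Matrix.of_apply, Fin.addCases_left, hij, Nat.add_sub_cancel_left]
      split_ifs
      · exact hg1
      · simpa using hD
    | right a =>
      simp only [s, Fin.addCases_right] at hij
      simp only [sylvester, Matrix.of_apply, Fin.addCases_right, hij, Nat.add_sub_cancel_left]
      split_ifs
      · exact hf1
      · simpa using hD
  · intro a b c hab hac hbc ha hb hc
    have hval : ∀ j : Fin (k + r), s j = 0 → (j : ℕ) = 0 ∨ (j : ℕ) = k := by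
      intro j hj
      induction j using Fin.addCases with
      | left a => left; simpa [s] using hj
      | right a =>
        right
        simp only [s, Fin.addCases_right] at hj
        simp [hj]
    have h1 := hval a ha
    have h2 := hval b hb
    have h3 := hval c hc
    rw [Ne, Fin.ext_iff] at hab hac hbc
    omega

/-! ### Growth of spaces of polynomials under multiplication by `X` -/

section Growth

variable {F : Type*} [Field F]

/-- The space `W + X W`. -/
noncomputable def xStep (W : Submodule F F[X]) : Submodule F F[X] :=
  W ⊔ W.map (LinearMap.mulLeft F X)

theorem le_xStep (W : Submodule F F[X]) : W ≤ xStep W := le_sup_left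

theorem X_mul_mem_xStep {W : Submodule F F[X]} {p : F[X]} (hp : p ∈ W) : X * p ∈ xStep W :=
  Submodule.mem_sup_right ⟨p, hp, rfl⟩

theorem xStep_le {W V : Submodule F F[X]} (h : W ≤ V) (h' : ∀ p ∈ W, X * p ∈ V) :
    xStep W ≤ V := by
  refine sup_le h ?_
  rintro _ ⟨p, hp, rfl⟩
  exact h' p hp

theorem X_mul_mem_degreeLT {p : F[X]} {N : ℕ} (hp : p ∈ degreeLT F N) :
    X * p ∈ degreeLT F (N + 1) := by
  rw [mem_degreeLT, degree_lt_iff_coeff_zero] at *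
  intro m hm
  obtain ⟨m, rfl⟩ : ∃ j, m = j + 1 := ⟨m - 1, by omega⟩
  rw [coeff_X_mul]
  exact hp m (by omega)

theorem degreeLT_le_succ (N : ℕ) : degreeLT F N ≤ degreeLT F (N + 1) :=
  degreeLT_mono (Nat.le_succ N)

theorem xStep_le_degreeLT {W : Submodule F F[X]} {N : ℕ} (h : W ≤ degreeLT F N) :
    xStep W ≤ degreeLT F (N + 1) :=
  xStep_le (h.trans (degreeLT_le_succ N)) fun _ hp => X_mul_mem_degreeLT (h hp)

theorem finiteDimensional_of_le_degreeLT {W : Submodule F F[X]} {N : ℕ} (h : W ≤ degreeLT F N) :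
    FiniteDimensional F W := by
  have : FiniteDimensional F (degreeLT F N) := Module.Finite.equiv (degreeLTEquiv F N).symm
  exact Submodule.finiteDimensional_of_le h

theorem not_X_mul_closed {W : Submodule F F[X]} {N : ℕ} (h : W ≤ degreeLT F N) (h0 : W ≠ ⊥) :
    ∃ p ∈ W, X * p ∉ W := by
  by_contra! hc
  obtain ⟨p, hp, hp0⟩ := Submodule.exists_mem_ne_zero_of_ne_bot h0
  have : ∀ i, X ^ i * p ∈ W := by
    intro i
    induction i with
    | zero => simpa using hp
    | succ i ih => rw [pow_succ', mul_assoc]; exact hc _ ih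
  have h1 := h (this N)
  rw [mem_degreeLT, degree_lt_iff_coeff_zero] at h1
  have h2 := h1 (p.natDegree + N) (by omega)
  rw [coeff_X_pow_mul, coeff_natDegree, leadingCoeff_eq_zero] at h2
  exact hp0 h2

theorem mulLeft_injective {R : F[X]} (hR : R ≠ 0) : Function.Injective (LinearMap.mulLeft F R) :=
  mul_right_injective₀ hR

theorem finrank_map_mulLeft {R : F[X]} (hR : R ≠ 0) (W : Submodule F F[X]) :
    Module.finrank F (W.map (LinearMap.mulLeft F R)) = Module.finrank F W :=
  (Submodule.equivMapOfInjective _ (mulLeft_injective hR) W).finrank_eq.symm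

theorem mem_degreeLT_one {p : F[X]} (hp : p ∈ degreeLT F 1) : ∃ a : F, p = C a :=
  ⟨_, eq_C_of_natDegree_le_zero (natDegree_le_of_mem_degreeLT hp)⟩

theorem exists_eq_map_mulLeft (s : ℕ) : ∀ (W : Submodule F F[X]) (N : ℕ), W ≤ degreeLT F N →
    Module.finrank F W = s + 1 → Module.finrank F (xStep W) ≤ s + 2 →
    ∃ R : F[X], R ≠ 0 ∧ W = (degreeLT F (s + 1)).map (LinearMap.mulLeft F R) := by
  induction s with
  | zero =>
    intro W N hN hW _
    have hfd := finiteDimensional_of_le_degreeLT hN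
    have hbot : W ≠ ⊥ := by rintro rfl; simp at hW
    obtain ⟨p, hp, hp0⟩ := Submodule.exists_mem_ne_zero_of_ne_bot hbot
    refine ⟨p, hp0, (Submodule.eq_of_le_of_finrank_le ?_ ?_).symm⟩
    · rintro _ ⟨q, hq, rfl⟩
      obtain ⟨a, rfl⟩ := mem_degreeLT_one hq
      rw [LinearMap.mulLeft_apply, mul_comm, ← smul_eq_C_mul]
      exact W.smul_mem a hp
    · rw [finrank_map_mulLeft hp0, finrank_degreeLT, hW]
  | succ s ih =>
    intro W N hN hW hstep
    have hfd := finiteDimensional_of_le_degreeLT hN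
    have hbot : W ≠ ⊥ := by rintro rfl; simp at hW
    have hX : (X : F[X]) ≠ 0 := X_ne_zero
    set W' := W ⊓ W.comap (LinearMap.mulLeft F X) with hW'
    have hW'le : W' ≤ W := inf_le_left
    have hmap : W ⊓ W.map (LinearMap.mulLeft F X) = W'.map (LinearMap.mulLeft F X) := by
      ext p
      constructor
      · rintro ⟨h1, q, hq, rfl⟩
        exact ⟨q, ⟨hq, h1⟩, rfl⟩
      · rintro ⟨q, ⟨hq, h1⟩, rfl⟩
        exact ⟨h1, q, hq, rfl⟩
    have hfd2 : FiniteDimensional F (W.map (LinearMap.mulLeft F X)) := inferInstance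
    have hdim := Submodule.finrank_sup_add_finrank_inf_eq W (W.map (LinearMap.mulLeft F X))
    rw [hmap, finrank_map_mulLeft hX, finrank_map_mulLeft hX] at hdim
    change Module.finrank F (xStep W) + _ = _ at hdim
    have hlt : W' < W := by
      refine lt_of_le_of_ne hW'le fun he => ?_
      obtain ⟨p, hp, hp'⟩ := not_X_mul_closed hN hbot
      rw [← he] at hp
      exact hp' hp.2
    have hlt' := Submodule.finrank_lt_finrank_of_lt hlt
    have hstepW' : xStep W' ≤ W := xStep_le hW'le fun p hp => hp.2
    have hstep' := Submodule.finrank_mono hstepW'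
    obtain ⟨R, hR, hRW⟩ := ih W' N (hW'le.trans hN) (by omega) (by omega)
    refine ⟨R, hR, ?_⟩
    have hW'bot : W' ≠ ⊥ := by
      intro h0
      rw [h0, finrank_bot] at hdim
      omega
    have hsub : xStep W' ≤ (degreeLT F (s + 1 + 1)).map (LinearMap.mulLeft F R) := by
      rw [hRW]
      refine xStep_le (Submodule.map_mono (degreeLT_le_succ _)) ?_
      rintro _ ⟨q, hq, rfl⟩
      refine ⟨X * q, X_mul_mem_degreeLT hq, ?_⟩
      simp only [LinearMap.mulLeft_apply]
      ring
    have hgrow : Module.finrank F W' < Module.finrank F (xStep W') := by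
      have : FiniteDimensional F (xStep W') := Submodule.finiteDimensional_of_le hstepW'
      refine Submodule.finrank_lt_finrank_of_lt (lt_of_le_of_ne (le_xStep _) fun he => ?_)
      obtain ⟨p, hp, hp'⟩ := not_X_mul_closed (hW'le.trans hN) hW'bot
      exact hp' (by rw [he]; exact X_mul_mem_xStep hp)
    have heq : xStep W' = W := Submodule.eq_of_le_of_finrank_le hstepW' (by omega)
    rw [heq] at hsub
    have : FiniteDimensional F ((degreeLT F (s + 1 + 1)).map (LinearMap.mulLeft F R)) := by
      have : FiniteDimensional F (degreeLT F (s + 1 + 1)) :=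
        Module.Finite.equiv (degreeLTEquiv F _).symm
      infer_instance
    refine Submodule.eq_of_le_of_finrank_le hsub ?_
    rw [finrank_map_mulLeft hR, finrank_degreeLT, hW]

theorem iterate_xStep_le_degreeLT {W : Submodule F F[X]} {N : ℕ} (h : W ≤ degreeLT F N) (j : ℕ) :
    xStep^[j] W ≤ degreeLT F (N + j) := by
  induction j with
  | zero => exact h
  | succ j ih => rw [Function.iterate_succ_apply']; exact xStep_le_degreeLT ih

theorem iterate_xStep_mono (W : Submodule F F[X]) : Monotone fun j => xStep^[j] W := by
  refine monotone_nat_of_le_succ fun j => ?_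
  simp only [Function.iterate_succ_apply']
  exact le_xStep _

theorem exists_mem_iterate_xStep {k n : ℕ} (hkn : k ≤ n) (hnk : n < 2 * k)
    {W : Submodule F F[X]} (hW : W ≤ degreeLT F (k + 1))
    (hdim : 2 * k + 1 ≤ Module.finrank F W + n) :
    ∃ R : F[X], R ≠ 0 ∧ (∀ T ∈ W, R ∣ T) ∧ R ∈ xStep^[n - k] W ∧ X * R ∈ xStep^[n - k] W := by
  have hfd : ∀ j, FiniteDimensional F (xStep^[j] W : Submodule F F[X]) := fun j =>
    finiteDimensional_of_le_degreeLT (iterate_xStep_le_degreeLT hW j)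
  by_cases h : ∃ j < n - k, Module.finrank F (xStep^[j + 1] W : Submodule F F[X]) ≤
      Module.finrank F (xStep^[j] W : Submodule F F[X]) + 1
  · obtain ⟨j, hj, hle⟩ := h
    have hWj : W ≤ xStep^[j] W := iterate_xStep_mono W (Nat.zero_le j)
    have hr := Submodule.finrank_mono hWj
    obtain ⟨s, hs⟩ : ∃ s, Module.finrank F (xStep^[j] W : Submodule F F[X]) = s + 2 :=
      ⟨Module.finrank F (xStep^[j] W : Submodule F F[X]) - 2, by omega⟩
    rw [Function.iterate_succ_apply'] at hle
    obtain ⟨R, hR, hRW⟩ := exists_eq_map_mulLeft (s + 1) _ _ (iterate_xStep_le_degreeLT hW j) hs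
      (by omega)
    have hmono : xStep^[j] W ≤ xStep^[n - k] W := iterate_xStep_mono W hj.le
    have hmem : ∀ q : F[X], q.natDegree ≤ 1 → R * q ∈ xStep^[n - k] W := by
      intro q hq
      apply hmono
      rw [hRW]
      refine ⟨q, ?_, rfl⟩
      rw [SetLike.mem_coe, mem_degreeLT]
      refine lt_of_le_of_lt degree_le_natDegree ?_
      exact_mod_cast (by omega : q.natDegree < s + 1 + 1)
    refine ⟨R, hR, fun T hT => ?_, ?_, ?_⟩
    · have := hWj hT
      rw [hRW] at this
      obtain ⟨q, -, rfl⟩ := this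
      exact dvd_mul_right _ _
    · simpa using hmem 1 (by simp)
    · rw [mul_comm]
      exact hmem X natDegree_X_le
  · push Not at h
    have hgrow : ∀ j ≤ n - k, Module.finrank F W + 2 * j ≤
        Module.finrank F (xStep^[j] W : Submodule F F[X]) := by
      intro j hj
      induction j with
      | zero => exact le_rfl
      | succ j ih =>
        have := h j (by omega)
        have := ih (by omega)
        omega
    have h1 := hgrow (n - k) le_rfl
    have h2 := iterate_xStep_le_degreeLT hW (n - k)
    have : FiniteDimensional F (degreeLT F (k + 1 + (n - k))) :=
      Module.Finite.equiv (degreeLTEquiv F _).symm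
    have heq : xStep^[n - k] W = degreeLT F (k + 1 + (n - k)) :=
      Submodule.eq_of_le_of_finrank_le h2 (by rw [finrank_degreeLT]; omega)
    have hmem : ∀ q : F[X], q.natDegree ≤ 1 → q ∈ xStep^[n - k] W := by
      intro q hq
      rw [heq, mem_degreeLT]
      refine lt_of_le_of_lt degree_le_natDegree ?_
      exact_mod_cast (by omega : q.natDegree < k + 1 + (n - k))
    refine ⟨1, one_ne_zero, fun T _ => one_dvd T, hmem 1 (by simp), ?_⟩
    rw [mul_one]
    exact hmem X natDegree_X_le

theorem natDegree_add_finrank_le {W : Submodule F F[X]} {k : ℕ} (hW : W ≤ degreeLT F (k + 1))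
    (hpos : 0 < Module.finrank F W) {R : F[X]} (hR : R ≠ 0) (hdvd : ∀ T ∈ W, R ∣ T) :
    R.natDegree + Module.finrank F W ≤ k + 1 := by
  have hle : W ≤ (degreeLT F (k + 1 - R.natDegree)).map (LinearMap.mulLeft F R) := by
    intro T hT
    obtain ⟨q, rfl⟩ := hdvd T hT
    refine ⟨q, ?_, rfl⟩
    rcases eq_or_ne q 0 with rfl | hq
    · exact Submodule.zero_mem _
    have h1 := natDegree_le_of_mem_degreeLT (hW hT)
    rw [natDegree_mul hR hq] at h1
    rw [SetLike.mem_coe, mem_degreeLT]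
    refine lt_of_le_of_lt degree_le_natDegree ?_
    exact_mod_cast (by omega : q.natDegree < k + 1 - R.natDegree)
  have : FiniteDimensional F ((degreeLT F (k + 1 - R.natDegree)).map (LinearMap.mulLeft F R)) := by
    have : FiniteDimensional F (degreeLT F (k + 1 - R.natDegree)) :=
      Module.Finite.equiv (degreeLTEquiv F _).symm
    infer_instance
  have h1 := Submodule.finrank_mono hle
  rw [finrank_map_mulLeft hR, finrank_degreeLT] at h1
  omega

end Growth

theorem ratSpan_mono {S S' : Set ℤ[X]} (h : S ⊆ S') : ratSpan S ≤ ratSpan S' :=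
  Submodule.span_mono (Set.image_mono h)

theorem toRat_mem_ratSpan {S : Set ℤ[X]} {T : ℤ[X]} (h : T ∈ S) : toRat T ∈ ratSpan S :=
  Submodule.subset_span ⟨T, h, rfl⟩

theorem iterate_xStep_ratSpan_le (S : Set ℤ[X]) (j : ℕ) :
    xStep^[j] (ratSpan S) ≤ ratSpan {U | ∃ i ≤ j, ∃ T ∈ S, U = X ^ i * T} := by
  induction j with
  | zero => exact ratSpan_mono fun T hT => ⟨0, le_rfl, T, hT, by simp⟩
  | succ j ih =>
    rw [Function.iterate_succ_apply']
    refine xStep_le (ih.trans (ratSpan_mono ?_)) fun p hp => ?_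
    · rintro U ⟨i, hi, T, hT, rfl⟩
      exact ⟨i, by omega, T, hT, rfl⟩
    · have hle : ratSpan {U | ∃ i ≤ j, ∃ T ∈ S, U = X ^ i * T} ≤
          (ratSpan {U | ∃ i ≤ j + 1, ∃ T ∈ S, U = X ^ i * T}).comap (LinearMap.mulLeft ℚ X) := by
        rw [ratSpan, Submodule.span_le]
        rintro _ ⟨_, ⟨i, hi, T, hT, rfl⟩, rfl⟩
        have : X * toRat (X ^ i * T) = toRat (X ^ (i + 1) * T) := by
          simp only [toRat, Polynomial.map_mul, Polynomial.map_pow, map_X]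
          ring
        change X * toRat (X ^ i * T) ∈ ratSpan {U | ∃ i ≤ j + 1, ∃ T ∈ S, U = X ^ i * T}
        rw [this]
        exact toRat_mem_ratSpan ⟨i + 1, by omega, T, hT, rfl⟩
      exact hle (ih hp)

/-! ### Lower bounds for the values of polynomials of small degree -/

theorem exists_pos_le_abs_aeval {ξ : ℝ} (hξ : Transcendental ℚ ξ) (n : ℕ) (B : ℝ) :
    ∃ c : ℝ, 0 < c ∧ ∀ T : ℤ[X], T ≠ 0 → T.natDegree ≤ n → T.supNorm ≤ B → c ≤ |aeval ξ T| := by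
  set S := {T : ℤ[X] | T ≠ 0 ∧ T.natDegree ≤ n ∧ T.supNorm ≤ B} with hS
  have hfin : S.Finite := (finite_supNorm_le n B).subset fun T hT => hT.2
  rcases S.eq_empty_or_nonempty with h | h
  · refine ⟨1, one_pos, fun T h1 h2 h3 => ?_⟩
    have : T ∈ S := ⟨h1, h2, h3⟩
    rw [h] at this
    exact this.elim
  · obtain ⟨T0, hT0, hmin⟩ := Set.exists_min_image S (fun T => |aeval ξ T|) hfin h
    exact ⟨_, abs_pos.mpr (aeval_ne_zero_of_transcendental hξ hT0.1),
      fun T h1 h2 h3 => hmin T ⟨h1, h2, h3⟩⟩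

theorem exists_isPrimitive_eq_C_mul {R : ℚ[X]} (hR : R ≠ 0) :
    ∃ R₀ : ℤ[X], R₀.IsPrimitive ∧ ∃ c : ℚ, c ≠ 0 ∧ R = C c * toRat R₀ := by
  obtain ⟨b, hbM, hb⟩ := IsLocalization.integerNormalization_spec (nonZeroDivisors ℤ) R
  set N := IsLocalization.integerNormalization (nonZeroDivisors ℤ) R
  have hb0 : (b : ℚ) ≠ 0 := by exact_mod_cast nonZeroDivisors.ne_zero hbM
  have h1 : toRat N = C (b : ℚ) * R := by
    refine Eq.trans hb ?_
    ext i
    simp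
  have hN : N ≠ 0 := by
    intro h0
    rw [h0, toRat, Polynomial.map_zero] at h1
    exact mul_ne_zero (C_ne_zero.mpr hb0) hR h1.symm
  have hc : (N.content : ℚ) ≠ 0 := by exact_mod_cast mt content_eq_zero_iff.mp hN
  refine ⟨N.primPart, N.isPrimitive_primPart, N.content / b, div_ne_zero hc hb0, ?_⟩
  have h2 : toRat N = C (N.content : ℚ) * toRat N.primPart := by
    conv_lhs => rw [N.eq_C_content_mul_primPart]
    rw [toRat, Polynomial.map_mul, map_C]
    rfl
  have h3 : C (b : ℚ) * R = C (N.content : ℚ) * toRat N.primPart := h1.symm.trans h2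
  have h4 : R = C (b : ℚ)⁻¹ * (C (b : ℚ) * R) := by
    rw [← mul_assoc, ← C_mul, inv_mul_cancel₀ hb0, C_1, one_mul]
  rw [h4, h3, ← mul_assoc, ← C_mul, div_eq_inv_mul]

theorem isCoprime_toRat {P Q : ℤ[X]} (hP : P ≠ 0)
    (h : ∀ d : ℤ[X], d ∣ P → d ∣ Q → d.natDegree = 0) : IsCoprime (toRat P) (toRat Q) := by
  refine isCoprime_of_irreducible_dvd ?_ ?_
  · rintro ⟨h0, -⟩
    exact hP ((Polynomial.map_eq_zero_iff (RingHom.injective_int (Int.castRingHom ℚ))).mp h0)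
  · intro z hz hzP hzQ
    obtain ⟨z₀, hz₀, c, hc, rfl⟩ := exists_isPrimitive_eq_C_mul hz.ne_zero
    have h1 : z₀ ∣ P := (IsPrimitive.Int.dvd_iff_map_cast_dvd_map_cast z₀ P hz₀).mpr
      ((dvd_mul_left _ _).trans hzP)
    have h2 : z₀ ∣ Q := (IsPrimitive.Int.dvd_iff_map_cast_dvd_map_cast z₀ Q hz₀).mpr
      ((dvd_mul_left _ _).trans hzQ)
    have h3 := hz.natDegree_pos
    rw [natDegree_C_mul hc, natDegree_toRat, h z₀ h1 h2] at h3
    exact lt_irrefl _ h3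

theorem mem_of_isCoprime {F : Type*} [Field F] {P Q : F[X]} (hPQ : IsCoprime P Q) {n : ℕ}
    (hP : 0 < P.natDegree) (hQ : P.natDegree + Q.natDegree ≤ n + 1) {V : Submodule F F[X]}
    (hVP : ∀ i, i + P.natDegree ≤ n → X ^ i * P ∈ V) (hVQ : ∀ i < P.natDegree, X ^ i * Q ∈ V)
    {f : F[X]} (hf : f.natDegree ≤ n) : f ∈ V := by
  have hP0 : P ≠ 0 := by rintro rfl; simp at hP
  obtain ⟨a, b, hab⟩ := hPQ
  set v := (f * b) % P with hv
  set u := f * a + (f * b) / P * Q with hu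
  have hdecomp : f = u * P + v * Q := by
    have h1 := EuclideanDomain.div_add_mod (f * b) P
    calc f = f * (a * P + b * Q) := by rw [hab, mul_one]
      _ = f * a * P + (f * b) * Q := by ring
      _ = f * a * P + (P * (f * b / P) + f * b % P) * Q := by rw [h1]
      _ = u * P + v * Q := by rw [hu, hv]; ring
  have hvdeg : v.natDegree < P.natDegree := natDegree_mod_lt _ hP.ne'
  have hsum : ∀ (w R : F[X]) (N : ℕ), w.natDegree < N → (∀ i < N, X ^ i * R ∈ V) → w * R ∈ V := by
    intro w R N hw hR
    rw [w.as_sum_range' N hw, Finset.sum_mul]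
    refine V.sum_mem fun i hi => ?_
    rw [← C_mul_X_pow_eq_monomial, mul_assoc, ← smul_eq_C_mul]
    exact V.smul_mem _ (hR i (Finset.mem_range.mp hi))
  have hvQ : (v * Q).natDegree ≤ n := natDegree_mul_le.trans (by omega)
  rw [hdecomp]
  refine V.add_mem ?_ (hsum v Q _ hvdeg hVQ)
  rcases eq_or_ne u 0 with h0 | h0
  · rw [h0, zero_mul]; exact V.zero_mem
  have huP : (u * P).natDegree ≤ n := by
    rw [show u * P = f - v * Q by rw [hdecomp]; ring]
    exact (natDegree_sub_le _ _).trans (max_le hf hvQ)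
  rw [natDegree_mul h0 hP0] at huP
  exact hsum u P (u.natDegree + 1) (by omega) fun i hi => hVP i (by omega)

theorem X_pow_mul_mem_smallPolys {n i : ℕ} {ξ Y δ : ℝ} {T : ℤ[X]} (hT : T.natDegree + i ≤ n)
    (hY : T.supNorm ≤ Y) (hδ : |aeval ξ T| ≤ δ) :
    X ^ i * T ∈ smallPolys n ξ Y ((1 + |ξ|) ^ n * δ) := by
  refine ⟨?_, (supNorm_X_pow_mul_le T i).trans hY, ?_⟩
  · refine natDegree_mul_le.trans ?_
    rw [natDegree_X_pow]; omega
  · rw [map_mul, map_pow, aeval_X, abs_mul, abs_pow]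
    gcongr
    calc |ξ| ^ i ≤ (1 + |ξ|) ^ i := by gcongr; simp
      _ ≤ (1 + |ξ|) ^ n := pow_le_pow_right₀ (by simp) (by omega)

theorem ApproxBound.irreducible_value_bound {n m : ℕ} {ξ ω : ℝ} (hξ : Transcendental ℚ ξ)
    (hω : 0 ≤ ω) (h : ApproxBound n ξ ω) (hm : 1 ≤ m) (hmn : m ≤ n) (hωm : ω < (n - m + 1 : ℕ)) :
    ∃ c : ℝ, 0 < c ∧ ∀ P : ℤ[X], Irreducible P → 0 < P.natDegree → P.natDegree ≤ m →
      c * P.supNorm ^ (-ω) ≤ |aeval ξ P| := by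
  obtain ⟨cD, hcD, hDS⟩ := h.le_of_mem_ratSpan hω
  set e := n - m + 1 with he
  obtain ⟨K, hK, hdir⟩ := exists_dirichlet e ξ
  set g := gelfondConst n with hgdef
  have hg : 1 ≤ g := one_le_gelfondConst n
  set μ := (1 + |ξ|) ^ n with hμdef
  have hμ : 0 < μ := by positivity
  set K' := μ * K * (2 * g) ^ e / cD with hK'
  have hK'pos : 0 < K' := by positivity
  have heω : 0 < (e : ℝ) - ω := by linarith
  set H₀ := max (2 * g) (K' ^ (1 / ((e : ℝ) - ω))) with hH₀
  obtain ⟨cf, hcf, hfin⟩ := exists_pos_le_abs_aeval hξ n H₀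
  refine ⟨min cf (cD / μ), lt_min hcf (by positivity), fun P hP hPpos hPm => ?_⟩
  have hP0 : P ≠ 0 := hP.ne_zero
  set H := P.supNorm with hH
  have hH1 : 1 ≤ H := one_le_supNorm hP0
  have hHω : H ^ (-ω) ≤ 1 := Real.rpow_le_one_of_one_le_of_nonpos hH1 (by linarith)
  have hHω0 : 0 ≤ H ^ (-ω) := by positivity
  by_cases hsmall : H ≤ H₀
  · calc min cf (cD / μ) * H ^ (-ω) ≤ cf * 1 := by
          gcongr; exact min_le_left _ _
      _ = cf := mul_one _
      _ ≤ _ := hfin P hP0 (by omega) hsmall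
  push Not at hsmall
  have hY1 : 1 ≤ H / (2 * g) := by
    rw [one_le_div (by positivity)]
    exact (le_max_left _ _).trans hsmall.le
  obtain ⟨Q, hQ0, hQe, hQY, hQv⟩ := hdir (H / (2 * g)) hY1
  have hndvd : ¬ P ∣ Q := by
    rintro ⟨R, rfl⟩
    have hR0 : R ≠ 0 := right_ne_zero_of_mul hQ0
    have h1 := supNorm_mul_supNorm_le hP0 hR0 (n := n) (by omega)
    have h2 := one_le_supNorm hR0
    have h3 : g * (P * R).supNorm ≤ H / 2 := by
      calc g * (P * R).supNorm ≤ g * (H / (2 * g)) := by gcongr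
        _ = H / 2 := by field_simp
    have h4 : H * 1 ≤ H * R.supNorm := by gcongr
    linarith
  have hcop : IsCoprime (toRat P) (toRat Q) := by
    refine isCoprime_toRat hP0 fun d hd hdQ => ?_
    rcases hP.dvd_iff.mp hd with h1 | h1
    · exact natDegree_eq_zero_of_isUnit h1
    · exact absurd (h1.dvd.trans hdQ) hndvd
  set δ := μ * max |aeval ξ P| (K / (H / (2 * g)) ^ e) with hδ
  have hmem : ∀ f : ℚ[X], f.natDegree ≤ n → f ∈ ratSpan (smallPolys n ξ H δ) := by
    intro f hf
    have hmap : ∀ (i : ℕ) (T : ℤ[X]), X ^ i * toRat T = toRat (X ^ i * T) := by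
      intro i T; simp [toRat]
    refine mem_of_isCoprime hcop (n := n) ?_ ?_ ?_ ?_ hf
    · rwa [natDegree_toRat]
    · rw [natDegree_toRat, natDegree_toRat]; omega
    · intro i hi
      rw [natDegree_toRat] at hi
      rw [hmap]
      exact toRat_mem_ratSpan (X_pow_mul_mem_smallPolys (by omega) le_rfl (le_max_left _ _))
    · intro i hi
      rw [natDegree_toRat] at hi
      rw [hmap]
      refine toRat_mem_ratSpan (X_pow_mul_mem_smallPolys (by omega) ?_
        (hQv.trans (le_max_right _ _)))
      refine hQY.trans (div_le_self (by positivity) (by linarith))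
  have h1 := hDS H δ hH1 (hmem 1 (by simp)) (hmem X (natDegree_X_le.trans (by omega)))
  rcases le_total |aeval ξ P| (K / (H / (2 * g)) ^ e) with hmax | hmax
  · exfalso
    rw [hδ, max_eq_right hmax, Real.rpow_neg (by positivity), div_pow, ← Real.rpow_natCast H e] at h1
    have h2 : H ^ ((e : ℝ) - ω) ≤ K' := by
      rw [Real.rpow_sub (by positivity), hK', le_div_iff₀ hcD]
      have h3 : 0 < H ^ ω := by positivity
      have h4 : 0 < H ^ (e : ℝ) := by positivity
      rw [div_mul_eq_mul_div, div_le_iff₀ h3]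
      field_simp at h1
      linarith
    have h5 : H ≤ K' ^ (1 / ((e : ℝ) - ω)) := by
      have h6 := Real.rpow_le_rpow (by positivity) h2 (by positivity : 0 ≤ 1 / ((e : ℝ) - ω))
      rwa [← Real.rpow_mul (by positivity), mul_one_div_cancel heω.ne', Real.rpow_one] at h6
    exact absurd (h5.trans (le_max_right _ _)) (not_le.mpr hsmall)
  · rw [hδ, max_eq_left hmax] at h1
    calc min cf (cD / μ) * H ^ (-ω) ≤ cD / μ * H ^ (-ω) := by
          gcongr; exact min_le_right _ _
      _ ≤ _ := by rw [div_mul_eq_mul_div, div_le_iff₀ hμ]; linarith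

/-- All nonzero integer polynomials of degree at most `m` satisfy `|T(ξ)| ≫ H(T) ^ (-κ)`. -/
def ValueBound (m : ℕ) (ξ κ : ℝ) : Prop :=
  ∃ c : ℝ, 0 < c ∧ ∀ T : ℤ[X], T ≠ 0 → T.natDegree ≤ m → c * T.supNorm ^ (-κ) ≤ |aeval ξ T|

theorem value_bound_of_irreducible_factors {m : ℕ} {ξ κ : ℝ} (hκ : 0 ≤ κ) {c : ℝ} (hc : 0 < c)
    (h : ∀ P : ℤ[X], Irreducible P → 0 < P.natDegree → P.natDegree ≤ m →
      c * P.supNorm ^ (-κ) ≤ |aeval ξ P|) (k : ℕ) :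
    ∃ c' : ℝ, 0 < c' ∧ ∀ T : ℤ[X], T ≠ 0 → T.natDegree ≤ k →
      (∀ A : ℤ[X], Irreducible A → A ∣ T → A.natDegree ≤ m) →
      c' * T.supNorm ^ (-κ) ≤ |aeval ξ T| := by
  set c' := min 1 (c * ((2 : ℝ) ^ m) ^ (-κ)) with hc'
  have hc'pos : 0 < c' := lt_min one_pos (by positivity)
  have hirr : ∀ P : ℤ[X], Irreducible P → 0 < P.natDegree → P.natDegree ≤ m →
      c' * intMahler P ^ (-κ) ≤ |aeval ξ P| := by
    intro P hP h1 h2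
    refine le_trans ?_ (h P hP h1 h2)
    have h3 := supNorm_le_intMahler h2
    have h4 := one_le_supNorm hP.ne_zero
    have h5 := one_le_intMahler hP.ne_zero
    have h6 : ((2 : ℝ) ^ m * intMahler P) ^ (-κ) ≤ P.supNorm ^ (-κ) :=
      Real.rpow_le_rpow_of_nonpos (by linarith) h3 (by linarith)
    rw [Real.mul_rpow (by positivity) (by linarith)] at h6
    calc c' * intMahler P ^ (-κ) ≤ c * ((2 : ℝ) ^ m) ^ (-κ) * intMahler P ^ (-κ) := by
          gcongr; exact min_le_right _ _
      _ = c * (((2 : ℝ) ^ m) ^ (-κ) * intMahler P ^ (-κ)) := by ring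
      _ ≤ _ := by gcongr
  have hall : ∀ T : ℤ[X], T ≠ 0 →
      (∀ A : ℤ[X], Irreducible A → A ∣ T → A.natDegree ≤ m) → c' ^ T.natDegree * intMahler T ^ (-κ) ≤ |aeval ξ T| := by
    intro T
    have hconst : ∀ a : ℤ, a ≠ 0 → 1 ≤ |aeval ξ (C a : ℤ[X])| := by
      intro a ha
      rw [aeval_C]
      simpa using (by exact_mod_cast Int.one_le_abs ha : (1 : ℝ) ≤ |(a : ℝ)|)
    induction T using WfDvdMonoid.induction_on_irreducible with
    | zero => intro h0; exact absurd rfl h0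
    | unit u hu =>
      intro h0 _
      obtain ⟨r, hr, rfl⟩ := Polynomial.isUnit_iff.mp hu
      refine le_trans ?_ (hconst r hr.ne_zero)
      rw [natDegree_C, pow_zero, one_mul]
      exact Real.rpow_le_one_of_one_le_of_nonpos (one_le_intMahler h0) (by linarith)
    | mul a i ha hi ih =>
      intro h0 hfac
      have hi0 := hi.ne_zero
      rw [natDegree_mul hi0 ha] 
      rw [intMahler_mul, map_mul, abs_mul, Real.mul_rpow
        (by linarith [one_le_intMahler hi0]) (by linarith [one_le_intMahler ha]), pow_add]
      have h1 := ih ha fun A hA hd => hfac A hA (hd.mul_left _)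
      have h2 : c' ^ i.natDegree * intMahler i ^ (-κ) ≤ |aeval ξ i| := by
        rcases Nat.eq_zero_or_pos i.natDegree with h3 | h3
        · rw [h3, pow_zero, one_mul]
          obtain ⟨r, rfl⟩ := natDegree_eq_zero.mp h3
          refine le_trans ?_ (hconst r (by rintro rfl; simp at hi0))
          exact Real.rpow_le_one_of_one_le_of_nonpos (one_le_intMahler hi0) (by linarith)
        · refine le_trans ?_ (hirr i hi h3 (hfac i hi (dvd_mul_right _ _)))
          have := one_le_intMahler hi0
          gcongr
          calc c' ^ i.natDegree ≤ c' ^ 1 :=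
                pow_le_pow_of_le_one hc'pos.le (min_le_left _ _) h3
            _ = c' := pow_one _
      have h5 := one_le_intMahler ha
      have h6 := one_le_intMahler hi0
      calc c' ^ i.natDegree * c' ^ a.natDegree * (intMahler i ^ (-κ) * intMahler a ^ (-κ))
          = (c' ^ i.natDegree * intMahler i ^ (-κ)) * (c' ^ a.natDegree * intMahler a ^ (-κ)) := by
            ring
        _ ≤ _ := by gcongr
  refine ⟨c' ^ k * ((k : ℝ) + 1) ^ (-κ), by positivity, fun T hT hTm hfac => ?_⟩
  refine le_trans ?_ (hall T hT hfac)
  have h1 := intMahler_le_supNorm hTm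
  have h2 := one_le_intMahler hT
  have h3 : (((k : ℝ) + 1) * T.supNorm) ^ (-κ) ≤ intMahler T ^ (-κ) :=
    Real.rpow_le_rpow_of_nonpos (by linarith) h1 (by linarith)
  rw [Real.mul_rpow (by positivity) T.supNorm_nonneg] at h3
  rw [mul_assoc]
  have h4 := T.supNorm_nonneg
  exact mul_le_mul (pow_le_pow_of_le_one hc'pos.le (min_le_left _ _) hTm) h3 (by positivity)
    (by positivity)

theorem valueBound_of_irreducible {m : ℕ} {ξ κ : ℝ} (hκ : 0 ≤ κ) {c : ℝ} (hc : 0 < c)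
    (h : ∀ P : ℤ[X], Irreducible P → 0 < P.natDegree → P.natDegree ≤ m →
      c * P.supNorm ^ (-κ) ≤ |aeval ξ P|) : ValueBound m ξ κ := by
  obtain ⟨c', hc', hT⟩ := value_bound_of_irreducible_factors hκ hc h m
  exact ⟨c', hc', fun T h0 hm => hT T h0 hm fun A _ hd => (natDegree_le_of_dvd hd h0).trans hm⟩

theorem ApproxBound.valueBound {n m : ℕ} {ξ ω : ℝ} (hξ : Transcendental ℚ ξ) (hω : 0 ≤ ω)
    (h : ApproxBound n ξ ω) (hmn : m ≤ n) (hωm : ω < (n - m + 1 : ℕ)) : ValueBound m ξ ω := by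
  rcases Nat.eq_zero_or_pos m with rfl | hm
  · exact valueBound_of_irreducible hω one_pos fun P _ h1 h2 => by omega
  · obtain ⟨c, hc, hP⟩ := h.irreducible_value_bound hξ hω hm hmn hωm
    exact valueBound_of_irreducible hω hc hP

/-! ### Consecutive minimal polynomials with a small common factor -/

theorem exists_forall_div_pow_lt {k : ℕ} {κ c K : ℝ} (hκ : κ < k) (hc : 0 < c) :
    ∃ x₀ : ℝ, ∀ x : ℝ, x₀ ≤ x → 0 < x → K / x ^ k < c * x ^ (-κ) := by
  have h1 : Tendsto (fun x : ℝ => K * x ^ (-((k : ℝ) - κ))) atTop (nhds (K * 0)) :=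
    (tendsto_rpow_neg_atTop (by linarith)).const_mul K
  rw [mul_zero] at h1
  obtain ⟨x₀, hx₀⟩ := eventually_atTop.mp (h1.eventually (gt_mem_nhds hc))
  refine ⟨x₀, fun x hx hpos => ?_⟩
  have h2 := hx₀ x hx
  have h3 : K / x ^ k = K * x ^ (-((k : ℝ) - κ)) * x ^ (-κ) := by
    rw [mul_assoc, ← Real.rpow_add hpos, div_eq_mul_inv, ← Real.rpow_natCast, ← Real.rpow_neg hpos.le]
    congr 2
    ring
  rw [h3]
  have : 0 < x ^ (-κ) := by positivity
  gcongr

theorem exists_minimal_poly {ξ : ℝ} (k N : ℕ) (hN : 1 ≤ N) :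
    ∃ T : ℤ[X], T ≠ 0 ∧ T.natDegree ≤ k ∧ T.supNorm ≤ N ∧
      ∀ U : ℤ[X], U ≠ 0 → U.natDegree ≤ k → U.supNorm ≤ N → |aeval ξ T| ≤ |aeval ξ U| := by
  set S := {T : ℤ[X] | T ≠ 0 ∧ T.natDegree ≤ k ∧ T.supNorm ≤ N} with hS
  have hfin : S.Finite := (finite_supNorm_le k N).subset fun T hT => hT.2
  have h1 : (1 : ℤ[X]) ∈ S := by
    refine ⟨one_ne_zero, by simp, ?_⟩
    rw [← map_one C, supNorm_C]
    simpa using hN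
  obtain ⟨T, hT, hmin⟩ := Set.exists_min_image S (fun T => |aeval ξ T|) hfin ⟨1, h1⟩
  exact ⟨T, hT.1, hT.2.1, hT.2.2, fun U a b c => hmin U ⟨a, b, c⟩⟩

theorem exists_minimal_pair {k m : ℕ} {ξ κ : ℝ} (hξ : Transcendental ℚ ξ) (hκ0 : 0 ≤ κ)
    (hLB : ValueBound m ξ κ) (hκ : κ < k) (hkm : k ≤ 2 * m + 1) :
    ∃ K : ℝ, 0 < K ∧ ∀ x₀ : ℝ, ∃ B : ℝ, x₀ ≤ B ∧ 1 ≤ B ∧ ∃ P Q : ℤ[X], P ≠ 0 ∧ Q ≠ 0 ∧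
      P.natDegree ≤ k ∧ Q.natDegree ≤ k ∧ P.supNorm ≤ B ∧ Q.supNorm ≤ B + 1 ∧
      |aeval ξ Q| ≤ |aeval ξ P| ∧ |aeval ξ P| ≤ K / B ^ k ∧
      (∀ T : ℤ[X], T ≠ 0 → T.natDegree ≤ k → T.supNorm ≤ B → |aeval ξ P| ≤ |aeval ξ T|) ∧
      ∀ d : ℤ[X], d ∣ P → d ∣ Q → d.natDegree ≤ m := by
  obtain ⟨K, hK, hdir⟩ := exists_dirichlet k ξ
  obtain ⟨c, hc, hb⟩ := hLB
  obtain ⟨c', hc', hb'⟩ := value_bound_of_irreducible_factors hκ0 hc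
    (fun P hP _ hPm => hb P hP.ne_zero hPm) k
  choose! T hT0 hTk hTN hTmin using fun (N : ℕ) (hN : 1 ≤ N) => exists_minimal_poly (ξ := ξ) k N hN
  have hTK : ∀ N : ℕ, 1 ≤ N → |aeval ξ (T N)| ≤ K / (N : ℝ) ^ k := by
    intro N hN
    obtain ⟨U, hU0, hUk, hUN, hUv⟩ := hdir N (by exact_mod_cast hN)
    exact (hTmin N hN U hU0 hUk hUN).trans hUv
  refine ⟨K, hK, fun x₀ => ?_⟩
  obtain ⟨x₁, hx₁⟩ := exists_forall_div_pow_lt (K := K) hκ hc'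
  set N := max 1 (max ⌈x₀⌉₊ ⌈x₁⌉₊) with hN
  have hN1 : 1 ≤ N := le_max_left _ _
  have hN1' : (1 : ℝ) ≤ N := by exact_mod_cast hN1
  have hNx₀ : x₀ ≤ N := (Nat.le_ceil _).trans
    (by exact_mod_cast (le_max_left _ _).trans (le_max_right _ _))
  have hNx₁ : x₁ ≤ N := (Nat.le_ceil _).trans
    (by exact_mod_cast (le_max_right ⌈x₀⌉₊ _).trans (le_max_right _ _))
  have hA : ∃ A : ℤ[X], Irreducible A ∧ A ∣ T N ∧ m < A.natDegree := by
    by_contra! hcon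
    have h1 := hb' (T N) (hT0 N hN1) (hTk N hN1) hcon
    have h2 := hTK N hN1
    have h3 := hx₁ N hNx₁ (by linarith)
    have h4 : (N : ℝ) ^ (-κ) ≤ (T N).supNorm ^ (-κ) :=
      Real.rpow_le_rpow_of_nonpos (by linarith [one_le_supNorm (hT0 N hN1)]) (hTN N hN1)
        (by linarith)
    have h5 : c' * (N : ℝ) ^ (-κ) ≤ c' * (T N).supNorm ^ (-κ) := by gcongr
    linarith
  obtain ⟨A, hAirr, hAdvd, hAm⟩ := hA
  have hA0 : A ≠ 0 := hAirr.ne_zero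
  have hcof : ∀ N', 1 ≤ N' → ∀ R, T N' = A * R → R ≠ 0 ∧ R.natDegree ≤ m := by
    intro N' hN' R hR
    have hR0 : R ≠ 0 := by
      rintro rfl
      exact hT0 N' hN' (by rw [hR, mul_zero])
    have h1 := hTk N' hN'
    rw [hR, natDegree_mul hA0 hR0] at h1
    exact ⟨hR0, by omega⟩
  have hex : ∃ N', N ≤ N' ∧ ¬ A ∣ T N' := by
    by_contra! hcon
    set g := gelfondConst k with hg
    have hg1 : 1 ≤ g := one_le_gelfondConst k
    have hAξ : 0 < |aeval ξ A| := abs_pos.mpr (aeval_ne_zero_of_transcendental hξ hA0)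
    obtain ⟨x₂, hx₂⟩ := exists_forall_div_pow_lt (K := K) (c := |aeval ξ A| * c * g ^ (-κ)) hκ
      (by positivity)
    set N' := max N ⌈x₂⌉₊ with hN'
    have hN'1 : 1 ≤ N' := hN1.trans (le_max_left _ _)
    have hN'1' : (1 : ℝ) ≤ N' := by exact_mod_cast hN'1
    obtain ⟨R, hR⟩ := hcon N' (le_max_left _ _)
    obtain ⟨hR0, hRm⟩ := hcof N' hN'1 R hR
    have h1 := hb R hR0 hRm
    have h2 := hTK N' hN'1
    rw [hR, map_mul, abs_mul] at h2
    have h3 := supNorm_mul_supNorm_le hA0 hR0 (n := k) (by rw [← hR]; exact hTk N' hN'1)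
    rw [← hR] at h3
    have h4 : R.supNorm ≤ g * N' := by
      calc R.supNorm ≤ A.supNorm * R.supNorm :=
            le_mul_of_one_le_left R.supNorm_nonneg (one_le_supNorm hA0)
        _ ≤ g * (T N').supNorm := h3
        _ ≤ g * N' := by gcongr; exact hTN N' hN'1
    have h5 : (g * N') ^ (-κ) ≤ R.supNorm ^ (-κ) :=
      Real.rpow_le_rpow_of_nonpos (by linarith [one_le_supNorm hR0]) h4 (by linarith)
    rw [Real.mul_rpow (by linarith) (by linarith)] at h5
    have h6 := hx₂ N' ((Nat.le_ceil _).trans (by exact_mod_cast le_max_right _ _)) (by linarith)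
    have h7 : |aeval ξ A| * c * g ^ (-κ) * (N' : ℝ) ^ (-κ) ≤ |aeval ξ A| * |aeval ξ R| := by
      calc |aeval ξ A| * c * g ^ (-κ) * (N' : ℝ) ^ (-κ)
          = |aeval ξ A| * (c * (g ^ (-κ) * (N' : ℝ) ^ (-κ))) := by ring
        _ ≤ |aeval ξ A| * (c * R.supNorm ^ (-κ)) := by gcongr
        _ ≤ _ := by gcongr
    linarith
  classical
  obtain ⟨hN1le, hN1nd⟩ := Nat.find_spec hex
  have hNmin : ∀ j < Nat.find hex, N ≤ j → A ∣ T j := by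
    intro j hj hNj
    have := Nat.find_min hex hj
    push Not at this
    exact this hNj
  set M := Nat.find hex with hM
  have hMN : N < M := lt_of_le_of_ne hN1le fun h => hN1nd (h ▸ hAdvd)
  obtain ⟨b, hb1⟩ : ∃ b, M = b + 1 := ⟨M - 1, by omega⟩
  rw [hb1] at hN1nd hMN
  have hNb : N ≤ b := by omega
  have hb1' : 1 ≤ b := hN1.trans hNb
  obtain ⟨R, hR⟩ := hNmin b (by omega) hNb
  obtain ⟨hR0, hRm⟩ := hcof b hb1' R hR
  refine ⟨b, hNx₀.trans (by exact_mod_cast hNb), by exact_mod_cast hb1', T b, T (b + 1), hT0 b hb1',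
    hT0 _ (by omega), hTk b hb1', hTk _ (by omega), hTN b hb1', ?_, ?_, hTK b hb1', hTmin b hb1',
    ?_⟩
  · exact_mod_cast hTN (b + 1) (by omega)
  · refine hTmin (b + 1) (by omega) _ (hT0 b hb1') (hTk b hb1') ((hTN b hb1').trans ?_)
    push_cast; linarith
  · intro d hdP hdQ
    have hnd : ¬ A ∣ d := fun h => hN1nd (h.trans hdQ)
    have hrel : IsRelPrime A d := hAirr.isRelPrime_iff_not_dvd.mpr hnd
    rw [hR] at hdP
    exact (natDegree_le_of_dvd (hrel.symm.dvd_of_dvd_mul_left hdP) hR0).trans hRm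

/-! ### Lower bound for the values of consecutive minimal polynomials -/

theorem ApproxBound.one_le_of_isCoprime {k : ℕ} {ξ ω : ℝ} (hω : 0 ≤ ω) (h : ApproxBound k ξ ω)
    (hk : 3 ≤ k) :
    ∃ K : ℝ, 0 < K ∧ ∀ (P Q : ℤ[X]) (B ε : ℝ), IsCoprime (toRat P) (toRat Q) → Q ≠ 0 →
      P.natDegree ≤ k → Q.natDegree ≤ k → 1 ≤ B → P.supNorm ≤ B → Q.supNorm ≤ B →
      |aeval ξ P| ≤ ε → |aeval ξ Q| ≤ ε →
      1 ≤ K * (B ^ (2 * k - 2) * ε ^ 2 + B ^ (2 * k + 2 * ω - 1) * ε ^ 3) := by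
  obtain ⟨C, hC, hder⟩ := h.derivative_bound hω
  obtain ⟨K, hK, hres⟩ := _root_.one_le_of_isCoprime hk ξ
  refine ⟨K * (1 + C + C ^ 2), by positivity, ?_⟩
  intro P Q B ε hcop hQ0 hPk hQk hB hPB hQB hPε hQε
  have hBpos : 0 < B := by linarith
  have hε0 : 0 ≤ ε := (abs_nonneg _).trans hPε
  set E := C ^ 2 * ε ^ 2 * B ^ (2 * ω + 2) + C * ε * B with hE
  have hE1 : 0 ≤ C ^ 2 * ε ^ 2 * B ^ (2 * ω + 2) := by positivity
  have hE2 : 0 ≤ C * ε * B := by positivity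
  have hε2 : 0 ≤ ε ^ 2 := by positivity
  set D := Real.sqrt (ε ^ 2 + E) with hD
  have hD2 : D ^ 2 = ε ^ 2 + E := Real.sq_sqrt (by linarith)
  have hderiv : ∀ U : ℤ[X], U.natDegree ≤ k → U.supNorm ≤ B → |aeval ξ U| ≤ ε →
      |aeval ξ (derivative U)| ≤ D := by
    intro U hUk hUB hUε
    apply Real.le_sqrt_of_sq_le
    rcases hder U B hUk hUB with h1 | h1
    · have h2 : |aeval ξ (derivative U)| ≤ C * ε * B ^ (ω + 1) := h1.trans (by gcongr)
      have h3 : (C * ε * B ^ (ω + 1)) ^ 2 = C ^ 2 * ε ^ 2 * B ^ (2 * ω + 2) := by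
        rw [mul_pow, mul_pow, ← Real.rpow_natCast (B ^ (ω + 1)), ← Real.rpow_mul hBpos.le]
        congr 2
        push_cast
        ring
      calc _ ≤ (C * ε * B ^ (ω + 1)) ^ 2 := by gcongr
        _ = C ^ 2 * ε ^ 2 * B ^ (2 * ω + 2) := h3
        _ ≤ _ := by linarith
    · have h2 : C * |aeval ξ U| * B ≤ C * ε * B := by gcongr
      linarith
  have hmain := hres P Q B ε D hcop hQ0 hPk hQk hB hPB hQB hPε hQε
    (hderiv P hPk hPB hPε) (hderiv Q hQk hQB hQε) (Real.le_sqrt_of_sq_le (by linarith))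
  have hpow1 : 1 ≤ B ^ (2 * ω + 2) := Real.one_le_rpow hB (by linarith)
  have hsum : ε ^ 2 * B + ε * D ^ 2 ≤
      (1 + C + C ^ 2) * (B * ε ^ 2 + B ^ (2 * ω + 2) * ε ^ 3) := by
    have h1 : ε ^ 3 ≤ B ^ (2 * ω + 2) * ε ^ 3 := le_mul_of_one_le_left (by positivity) hpow1
    have h2 : 0 ≤ B * ε ^ 2 := by positivity
    have h3 : 0 ≤ C ^ 2 * (B * ε ^ 2) := by positivity
    have h4 : 0 ≤ C * (B ^ (2 * ω + 2) * ε ^ 3) := by positivity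
    calc ε ^ 2 * B + ε * D ^ 2 = (1 + C) * (B * ε ^ 2) + ε ^ 3 +
          C ^ 2 * (B ^ (2 * ω + 2) * ε ^ 3) := by rw [hD2, hE]; ring
      _ ≤ _ := by linarith
  have hnat1 : B ^ (2 * k - 3) * B = B ^ (2 * k - 2) := by
    rw [← pow_succ]; congr 1; omega
  have hnat2 : B ^ (2 * k - 3) * B ^ (2 * ω + 2) = B ^ (2 * k + 2 * ω - 1) := by
    rw [← Real.rpow_natCast, ← Real.rpow_add hBpos]
    congr 1
    rw [Nat.cast_sub (by omega)]
    push_cast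
    ring
  calc 1 ≤ K * (B ^ (2 * k - 3) * (ε ^ 2 * B + ε * D ^ 2)) := hmain
    _ ≤ K * (B ^ (2 * k - 3) * ((1 + C + C ^ 2) * (B * ε ^ 2 + B ^ (2 * ω + 2) * ε ^ 3))) := by
        gcongr
    _ = K * (1 + C + C ^ 2) * (B ^ (2 * k - 3) * B * ε ^ 2 +
          B ^ (2 * k - 3) * B ^ (2 * ω + 2) * ε ^ 3) := by ring
    _ = _ := by rw [hnat1, hnat2]

theorem rescaled_first_term_le {k : ℕ} {g B t ε κ a K₀ : ℝ} (hk : 3 ≤ k) (hκ : κ ≤ k - 1)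
    (hg : 0 < g) (hB : 0 < B) (ht : 1 ≤ t) (hε : 0 ≤ ε) (ha : 0 < a) (hK₀ : ε ≤ K₀ / B ^ k) :
    (2 * g * B / t) ^ (2 * k - 2) * (ε * t ^ κ / a) ^ 2 ≤
      (2 * g) ^ (2 * k - 2) / a ^ 2 * K₀ ^ 2 / B ^ 2 := by
  have htpos : 0 < t := by linarith
  have h1 : (t ^ κ) ^ 2 ≤ t ^ (2 * k - 2) := by
    have h2 : t ^ κ ≤ t ^ (k - 1) := by
      rw [← Real.rpow_natCast]
      apply Real.rpow_le_rpow_of_exponent_le ht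
      rw [Nat.cast_sub (by omega)]
      simpa using hκ
    calc (t ^ κ) ^ 2 ≤ (t ^ (k - 1)) ^ 2 := by gcongr
      _ = t ^ (2 * k - 2) := by rw [← pow_mul]; congr 1; omega
  have h3 : B ^ (2 * k - 2) * ε ^ 2 ≤ K₀ ^ 2 / B ^ 2 := by
    have h4 : B ^ k * ε ≤ K₀ := by rwa [mul_comm, ← le_div_iff₀ (by positivity)]
    rw [le_div_iff₀ (by positivity)]
    calc B ^ (2 * k - 2) * ε ^ 2 * B ^ 2 = B ^ (2 * k - 2 + 2) * ε ^ 2 := by rw [pow_add]; ring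
      _ = (B ^ k * ε) ^ 2 := by
        rw [mul_pow, ← pow_mul]; congr 2; omega
      _ ≤ _ := by gcongr
  have h5 : (2 * g * B / t) ^ (2 * k - 2) * (ε * t ^ κ / a) ^ 2 = (2 * g) ^ (2 * k - 2) / a ^ 2 *
      (B ^ (2 * k - 2) * ε ^ 2) * ((t ^ κ) ^ 2 / t ^ (2 * k - 2)) := by
    generalize 2 * k - 2 = q
    rw [div_pow, mul_pow, div_pow, mul_pow]
    ring
  rw [h5]
  have h6 : (t ^ κ) ^ 2 / t ^ (2 * k - 2) ≤ 1 := by rwa [div_le_one (by positivity)]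
  calc _ ≤ (2 * g) ^ (2 * k - 2) / a ^ 2 * (K₀ ^ 2 / B ^ 2) * 1 := by gcongr
    _ = _ := by ring

theorem rescaled_second_term_le {l g B t ε κ a : ℝ} (hκ : 3 * κ ≤ l)
    (hg : 0 < g) (hB : 0 < B) (ht : 1 ≤ t) (hε : 0 ≤ ε) (ha : 0 < a) :
    (2 * g * B / t) ^ l * (ε * t ^ κ / a) ^ 3 ≤ (2 * g) ^ l / a ^ 3 * (B ^ l * ε ^ 3) := by
  have htpos : 0 < t := by linarith
  have h1 : (t ^ κ) ^ 3 ≤ t ^ l := by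
    rw [← Real.rpow_natCast, ← Real.rpow_mul htpos.le]
    apply Real.rpow_le_rpow_of_exponent_le ht
    push_cast
    linarith
  have h5 : (2 * g * B / t) ^ l * (ε * t ^ κ / a) ^ 3 = (2 * g) ^ l / a ^ 3 * (B ^ l * ε ^ 3) *
      ((t ^ κ) ^ 3 / t ^ l) := by
    rw [Real.div_rpow (by positivity) htpos.le, Real.mul_rpow (by positivity) hB.le,
      div_pow, mul_pow]
    ring
  rw [h5]
  have h6 : (t ^ κ) ^ 3 / t ^ l ≤ 1 := by
    have : 0 < t ^ l := by positivity
    rwa [div_le_one (by positivity)]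
  exact mul_le_of_le_one_right (by positivity) h6

theorem le_of_one_le_sum {l a b B ε : ℝ} (ha : 0 < a) (hb : 0 < b) (hB : 1 ≤ B)
    (haB : 2 * a ≤ B) (hε : 0 ≤ ε) (h : 1 ≤ a / B ^ 2 + b * (B ^ l * ε ^ 3)) :
    (1 / (2 * b)) ^ (1 / 3 : ℝ) * B ^ (-(l / 3)) ≤ ε := by
  have hBpos : 0 < B := by linarith
  have hsmall : a / B ^ 2 ≤ 1 / 2 := by
    rw [div_le_iff₀ (by positivity)]
    nlinarith
  have hBl : 0 < B ^ l := by positivity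
  have h7 : 1 / (2 * b) * B ^ (-l) ≤ ε ^ 3 := by
    rw [Real.rpow_neg hBpos.le, ← div_eq_mul_inv, div_le_iff₀ hBl, div_le_iff₀ (by positivity)]
    nlinarith
  have h8 : ((1 / (2 * b)) ^ (1 / 3 : ℝ) * B ^ (-(l / 3))) ^ 3 = 1 / (2 * b) * B ^ (-l) := by
    rw [mul_pow, ← Real.rpow_natCast, ← Real.rpow_natCast, ← Real.rpow_mul (by positivity),
      ← Real.rpow_mul (by positivity)]
    congr 1
    · norm_num
    · congr 1; push_cast; ring
  rw [← h8] at h7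
  exact le_of_pow_le_pow_left₀ (by norm_num) hε h7

theorem ApproxBound.minimal_pair_lower_bound {k m : ℕ} {ξ ω κ K₀ : ℝ} (hω : 0 ≤ ω)
    (h : ApproxBound k ξ ω) (hLB : ValueBound m ξ κ) (hk : 3 ≤ k) (hκ1 : κ ≤ k - 1)
    (hκ2 : 3 * κ ≤ 2 * k + 2 * ω - 1) (hK₀ : 0 < K₀) :
    ∃ c : ℝ, 0 < c ∧ ∃ x₁ : ℝ, ∀ (B : ℝ) (P Q : ℤ[X]), x₁ ≤ B → 1 ≤ B → P ≠ 0 → Q ≠ 0 →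
      P.natDegree ≤ k → Q.natDegree ≤ k → P.supNorm ≤ B → Q.supNorm ≤ B + 1 →
      |aeval ξ Q| ≤ |aeval ξ P| → |aeval ξ P| ≤ K₀ / B ^ k →
      (∀ d : ℤ[X], d ∣ P → d ∣ Q → d.natDegree ≤ m) →
      c * B ^ (-((2 * k + 2 * ω - 1) / 3)) ≤ |aeval ξ P| := by
  obtain ⟨cG, hcG, hG⟩ := hLB
  obtain ⟨K, hK, hres⟩ := h.one_le_of_isCoprime hω hk
  set g := gelfondConst k with hgdef
  have hg1 : 1 ≤ g := one_le_gelfondConst k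
  set l : ℝ := 2 * k + 2 * ω - 1 with hl
  have hk3 : (3 : ℝ) ≤ k := by exact_mod_cast hk
  have hlpos : 0 < l := by rw [hl]; linarith
  set C1 := K * ((2 * g) ^ (2 * k - 2) / cG ^ 2) * K₀ ^ 2 with hC1
  set C2 := K * ((2 * g) ^ l / cG ^ 3) with hC2
  have hC1pos : 0 < C1 := by positivity
  have hC2pos : 0 < C2 := by positivity
  refine ⟨(1 / (2 * C2)) ^ (1 / 3 : ℝ), by positivity, 2 * C1, ?_⟩
  intro B P Q hBx hB hP0 hQ0 hPk hQk hPB hQB hQP hPK hgcd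
  have hBpos : 0 < B := by linarith
  obtain ⟨R, S, G, hrel, hPG, hQG⟩ := UniqueFactorizationMonoid.exists_reduced_factors' P Q hQ0
  have hG0 : G ≠ 0 := by rintro rfl; simp at hPG; exact hP0 hPG.symm
  have hR0 : R ≠ 0 := by rintro rfl; simp at hPG; exact hP0 hPG.symm
  have hS0 : S ≠ 0 := by rintro rfl; simp at hQG; exact hQ0 hQG.symm
  have hGm : G.natDegree ≤ m := hgcd G ⟨R, hPG.symm⟩ ⟨S, hQG.symm⟩
  have hcop : IsCoprime (toRat R) (toRat S) :=
    isCoprime_toRat hR0 fun d hd1 hd2 => natDegree_eq_zero_of_isUnit (hrel hd1 hd2)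
  have hGb := hG G hG0 hGm
  set t := G.supNorm with ht
  have ht1 : 1 ≤ t := one_le_supNorm hG0
  have htpos : 0 < t := by linarith
  set ε := |aeval ξ P| with hε
  have hε0 : 0 ≤ ε := abs_nonneg _
  set X' := 2 * g * B / t with hX'
  set ε' := ε * t ^ κ / cG with hε'
  have hε'0 : 0 ≤ ε' := by positivity
  have htκ : 0 < t ^ κ := by positivity
  have hnorm : ∀ U V : ℤ[X], G * U = V → U ≠ 0 → V.natDegree ≤ k → V.supNorm ≤ B + 1 →
      U.supNorm ≤ X' := by
    rintro U _ rfl hU hdeg hV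
    have h1 := supNorm_mul_supNorm_le hG0 hU hdeg
    rw [hX', le_div_iff₀ htpos, mul_comm]
    refine h1.trans ?_
    calc g * (G * U).supNorm ≤ g * (B + 1) := by gcongr
      _ ≤ g * (2 * B) := by gcongr; linarith
      _ = _ := by ring
  have hvalue : ∀ U V : ℤ[X], G * U = V → |aeval ξ V| ≤ ε → |aeval ξ U| ≤ ε' := by
    rintro U _ rfl hV
    rw [map_mul, abs_mul] at hV
    rw [hε', le_div_iff₀ hcG]
    have h1 : cG * t ^ (-κ) * |aeval ξ U| ≤ ε :=
      (mul_le_mul_of_nonneg_right hGb (abs_nonneg _)).trans hV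
    have h2 : t ^ (-κ) * t ^ κ = 1 := by rw [← Real.rpow_add htpos]; simp
    calc |aeval ξ U| * cG = (cG * t ^ (-κ) * |aeval ξ U|) * t ^ κ := by
          linear_combination (-(|aeval ξ U| * cG)) * h2
      _ ≤ ε * t ^ κ := by gcongr
  have hRX := hnorm R P hPG hR0 hPk (by linarith)
  have hSX := hnorm S Q hQG hS0 hQk hQB
  have hRε := hvalue R P hPG le_rfl
  have hSε := hvalue S Q hQG hQP
  have hX1 : 1 ≤ X' := (one_le_supNorm hR0).trans hRX
  have hXpos : 0 < X' := by linarith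
  have hdegle : ∀ U V : ℤ[X], G * U = V → U ≠ 0 → V.natDegree ≤ k → U.natDegree ≤ k := by
    rintro U _ rfl hU hd
    rw [natDegree_mul hG0 hU] at hd
    omega
  have hRk := hdegle R P hPG hR0 hPk
  have hSk := hdegle S Q hQG hS0 hQk
  have hmain := hres R S X' ε' hcop hS0 hRk hSk hX1 hRX hSX hRε hSε
  have hterm1 : X' ^ (2 * k - 2) * ε' ^ 2 ≤ (2 * g) ^ (2 * k - 2) / cG ^ 2 * K₀ ^ 2 / B ^ 2 :=
    rescaled_first_term_le hk hκ1 (by linarith) hBpos ht1 hε0 hcG hPK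
  have hterm2 : X' ^ l * ε' ^ 3 ≤ (2 * g) ^ l / cG ^ 3 * (B ^ l * ε ^ 3) :=
    rescaled_second_term_le hκ2 (by linarith) hBpos ht1 hε0 hcG
  refine le_of_one_le_sum hC1pos hC2pos hB hBx hε0 (hmain.trans ?_)
  calc K * (X' ^ (2 * k - 2) * ε' ^ 2 + X' ^ l * ε' ^ 3)
      ≤ K * ((2 * g) ^ (2 * k - 2) / cG ^ 2 * K₀ ^ 2 / B ^ 2 +
            (2 * g) ^ l / cG ^ 3 * (B ^ l * ε ^ 3)) :=
        mul_le_mul_of_nonneg_left (add_le_add hterm1 hterm2) hK.le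
    _ = C1 / B ^ 2 + C2 * (B ^ l * ε ^ 3) := by rw [hC1, hC2]; ring

theorem toRat_mul (P Q : ℤ[X]) : toRat (P * Q) = toRat P * toRat Q := Polynomial.map_mul _

theorem dvd_of_toRat_dvd {R T : ℤ[X]} (hR : R.IsPrimitive) (h : toRat R ∣ toRat T) : R ∣ T :=
  (IsPrimitive.Int.dvd_iff_map_cast_dvd_map_cast R T hR).2 h

theorem one_le_of_one_mem_ratSpan {n : ℕ} {ξ Y δ : ℝ}
    (h : (1 : ℚ[X]) ∈ ratSpan (smallPolys n ξ Y δ)) : 1 ≤ Y := by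
  by_contra hY
  have hle : ratSpan (smallPolys n ξ Y δ) ≤ ⊥ := by
    rw [ratSpan, Submodule.span_le]
    rintro _ ⟨T, hT, rfl⟩
    have : T = 0 := by
      by_contra hT0
      exact hY ((one_le_supNorm hT0).trans hT.2.1)
    simp [this, toRat]
  exact one_ne_zero ((Submodule.mem_bot ℚ).1 (hle h))

theorem ratSpan_X_pow_mul_le {n k : ℕ} {ξ Y δ : ℝ} {R : ℤ[X]} (hkn : k ≤ n) (hR : R ≠ 0)
    (hξR : 0 < |aeval ξ R|) (hdvd : ∀ T ∈ smallPolys k ξ Y δ, R ∣ T) :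
    ratSpan {U | ∃ i ≤ n - k, ∃ T ∈ smallPolys k ξ Y δ, U = X ^ i * T} ≤
      (ratSpan (smallPolys n ξ (gelfondConst k * Y / R.supNorm)
        ((1 + |ξ|) ^ n * (δ / |aeval ξ R|)))).map (LinearMap.mulLeft ℚ (toRat R)) := by
  rw [ratSpan, Submodule.span_le]
  rintro _ ⟨_, ⟨i, hi, T, hT, rfl⟩, rfl⟩
  obtain ⟨U, rfl⟩ := hdvd T hT
  obtain ⟨hdeg, hsup, hval⟩ := hT
  have hRpos : 0 < R.supNorm := by linarith [one_le_supNorm hR]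
  refine ⟨toRat (X ^ i * U), toRat_mem_ratSpan (X_pow_mul_mem_smallPolys ?_ ?_ ?_), ?_⟩
  · by_cases hU : U = 0
    · subst hU; simp; omega
    · rw [natDegree_mul hR hU] at hdeg
      omega
  · rw [le_div_iff₀ hRpos, mul_comm]
    by_cases hU : U = 0
    · subst hU
      rw [mul_zero] at hsup
      simp only [supNorm_zero] at hsup ⊢
      rw [mul_zero]
      have := one_le_gelfondConst k
      positivity
    · refine (supNorm_mul_supNorm_le hR hU hdeg).trans ?_
      have := one_le_gelfondConst k
      gcongr
  · rw [le_div_iff₀ hξR, mul_comm, ← abs_mul, ← map_mul]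
    exact hval
  · rw [LinearMap.mulLeft_apply, ← toRat_mul]
    congr 1
    ring

theorem mem_of_C_mul_mem_map_mulLeft {W : Submodule ℚ ℚ[X]} {R V : ℚ[X]} {c : ℚ} (hR : R ≠ 0)
    (hc : c ≠ 0) (h : V * (C c * R) ∈ W.map (LinearMap.mulLeft ℚ R)) : V ∈ W := by
  obtain ⟨u, hu, hu'⟩ := h
  rw [LinearMap.mulLeft_apply] at hu'
  have h1 : u = c • V := by
    apply mul_left_cancel₀ hR
    rw [hu', smul_eq_C_mul]
    ring
  have h2 : V = c⁻¹ • u := by rw [h1, smul_smul, inv_mul_cancel₀ hc, one_smul]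
  rw [h2]
  exact W.smul_mem _ hu

theorem ApproxBound.le_of_le_finrank {n k : ℕ} {ξ ω : ℝ} (hξ : Transcendental ℚ ξ) (hω : 0 ≤ ω)
    (h : ApproxBound n ξ ω) (hkn : k ≤ n) (hnk : n < 2 * k) (hωk : ω < k + 1) :
    ∃ c : ℝ, 0 < c ∧ ∀ Y δ : ℝ, 1 ≤ Y →
      2 * k + 1 ≤ Module.finrank ℚ (ratSpan (smallPolys k ξ Y δ)) + n → c * Y ^ (-ω) ≤ δ := by
  obtain ⟨c₁, hc₁, hV⟩ := h.valueBound hξ hω (m := n - k) (by omega) (by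
    rw [show n - (n - k) + 1 = k + 1 by omega]; push_cast; exact hωk)
  obtain ⟨c₀, hc₀, hD⟩ := h.le_of_mem_ratSpan hω
  have hg := one_le_gelfondConst k
  set g := gelfondConst k
  have hμ : 0 < (1 + |ξ|) ^ n := by positivity
  refine ⟨c₀ * c₁ * g ^ (-ω) / (1 + |ξ|) ^ n, by positivity, fun Y δ hY hdim => ?_⟩
  have hW : ratSpan (smallPolys k ξ Y δ) ≤ degreeLT ℚ (k + 1) :=
    ratSpan_le_degreeLT fun T hT => hT.1
  obtain ⟨R, hR0, hRdvd, hR1, hRX⟩ := exists_mem_iterate_xStep hkn hnk hW hdim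
  have hdegR := natDegree_add_finrank_le hW (by omega) hR0 hRdvd
  obtain ⟨R₀, hprim, c, hc, rfl⟩ := exists_isPrimitive_eq_C_mul hR0
  have hR₀' : toRat R₀ ≠ 0 := right_ne_zero_of_mul hR0
  have hR₀ : R₀ ≠ 0 := hprim.ne_zero
  have hdvd : ∀ T ∈ smallPolys k ξ Y δ, R₀ ∣ T := fun T hT =>
    dvd_of_toRat_dvd hprim ((Dvd.intro_left _ rfl).trans (hRdvd _ (toRat_mem_ratSpan hT)))
  have hξR : 0 < |aeval ξ R₀| := abs_pos.2 (aeval_ne_zero_of_transcendental hξ hR₀)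
  have hdeg : R₀.natDegree ≤ n - k := by
    rw [natDegree_C_mul hc, natDegree_toRat] at hdegR
    omega
  have hle := (iterate_xStep_ratSpan_le _ (n - k)).trans
    (ratSpan_X_pow_mul_le hkn hR₀ hξR hdvd)
  have h1 := mem_of_C_mul_mem_map_mulLeft (V := 1) hR₀' hc (by rw [one_mul]; exact hle hR1)
  have hX := mem_of_C_mul_mem_map_mulLeft (V := X) hR₀' hc (hle hRX)
  have hfin := hD _ _ (one_le_of_one_mem_ratSpan h1) h1 hX
  have hval := hV R₀ hR₀ hdeg
  have hh : 0 < R₀.supNorm := by linarith [one_le_supNorm hR₀]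
  have hYpos : 0 < Y := by linarith
  have hgpos : 0 < g := by linarith
  rw [Real.div_rpow (by positivity) hh.le, Real.mul_rpow hgpos.le hYpos.le] at hfin
  rw [← mul_div_assoc ((1 + |ξ|) ^ n), le_div_iff₀ hξR] at hfin
  have hhω : 0 < R₀.supNorm ^ (-ω) := by positivity
  rw [div_mul_eq_mul_div, div_le_iff₀ hμ, mul_comm δ]
  refine le_trans (le_of_eq ?_) ((mul_le_mul_of_nonneg_left hval (by positivity)).trans hfin)
  field_simp

theorem exists_lt_finrank_ratSpan {n k : ℕ} {ξ K₀ : ℝ} (hkn : k ≤ n) (hnk : n < 2 * k) :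
    ∃ A : ℝ, 0 < A ∧ ∀ B ε Y : ℝ, 1 ≤ B → 0 < ε → ε ≤ B → ε ≤ K₀ / B ^ k →
      (∀ T : ℤ[X], T ≠ 0 → T.natDegree ≤ k → T.supNorm ≤ B → ε ≤ |aeval ξ T|) → 0 < Y →
      Y ^ (n - k + 1) * (ε * B ^ (2 * k - n - 1)) = A →
      B ≤ Y ∧ 2 * k + 1 ≤ Module.finrank ℚ (ratSpan (smallPolys k ξ Y (Y * ε / B))) + n := by
  obtain ⟨c, hc, hcount⟩ := exists_le_ncard_smallPolys k ξ
  obtain ⟨i, rfl⟩ : ∃ i, n = 2 * k - (i + 1) := ⟨2 * k - n - 1, by omega⟩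
  obtain ⟨e, rfl⟩ : ∃ e, k = e + i + 1 := ⟨k - (i + 1), by omega⟩
  refine ⟨max (3 ^ (i + 1) / c + 1) (max K₀ 1), lt_max_of_lt_left (by positivity), ?_⟩
  rw [show 2 * (e + i + 1) - (2 * (e + i + 1) - (i + 1)) - 1 = i by omega,
    show 2 * (e + i + 1) - (i + 1) - (e + i + 1) + 1 = e + 1 by omega]
  set A := max (3 ^ (i + 1) / c + 1) (max K₀ 1) with hA
  intro B ε Y hB hε hεB hεK hmin hY hYA
  have hBpos : 0 < B := by linarith
  have hAK : K₀ ≤ A := (le_max_left _ _).trans (le_max_right _ _)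
  have hBY : B ≤ Y := by
    have h1 : ε * B ^ (e + i + 1) ≤ A :=
      ((le_div_iff₀ (by positivity)).1 hεK).trans hAK
    have h2 : B ^ (e + 1) ≤ Y ^ (e + 1) := by
      have h3 : 0 < ε * B ^ i := by positivity
      refine le_of_mul_le_mul_right ?_ h3
      rw [hYA]
      calc B ^ (e + 1) * (ε * B ^ i) = ε * B ^ (e + i + 1) := by ring
        _ ≤ A := h1
    exact le_of_pow_le_pow_left₀ (by omega) hY.le h2
  refine ⟨hBY, ?_⟩
  by_contra hlt
  set r := Module.finrank ℚ (ratSpan (smallPolys (e + i + 1) ξ Y (Y * ε / B))) with hr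
  have hri : r ≤ i + 1 := by omega
  set M := ⌊2 * Y / B⌋₊ + 1 with hM
  have hM1 : 2 * Y / B < M := by rw [hM]; push_cast; exact Nat.lt_floor_add_one _
  have hM2 : (M : ℝ) ≤ 3 * Y / B := by
    have h1 : (⌊2 * Y / B⌋₊ : ℝ) ≤ 2 * Y / B := Nat.floor_le (by positivity)
    have h2 : 1 ≤ Y / B := by rwa [one_le_div hBpos]
    rw [hM]; push_cast
    calc (⌊2 * Y / B⌋₊ : ℝ) + 1 ≤ 2 * Y / B + Y / B := add_le_add h1 h2
      _ = _ := by ring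
  have hup := ncard_smallPolys_le (e + i + 1) ξ B ε Y (Y * ε / B) M hmin (by omega)
    (by rw [div_lt_iff₀ hBpos] at hM1; exact hM1.le)
    (by
      calc 2 * (Y * ε / B) = 2 * Y / B * ε := by ring
        _ < M * ε := by gcongr)
  have hlow := hcount Y (Y * ε / B) (by linarith) (by positivity)
    (by rw [div_le_iff₀ hBpos]; gcongr)
  have hup' : ((smallPolys (e + i + 1) ξ Y (Y * ε / B)).ncard : ℝ) ≤ (3 * Y / B) ^ (i + 1) := by
    calc ((smallPolys (e + i + 1) ξ Y (Y * ε / B)).ncard : ℝ) ≤ ((M ^ r : ℕ) : ℝ) := by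
          exact_mod_cast hup
      _ = (M : ℝ) ^ r := by push_cast; rfl
      _ ≤ (M : ℝ) ^ (i + 1) := by
          apply pow_le_pow_right₀ _ hri
          rw [hM]; push_cast; linarith [Nat.cast_nonneg (α := ℝ) ⌊2 * Y / B⌋₊]
      _ ≤ _ := by gcongr
  have h5 := hlow.trans hup'
  have h6 : c * A ≤ 3 ^ (i + 1) := by
    have h7 : 0 < (Y / B) ^ (i + 1) := by positivity
    refine le_of_mul_le_mul_right ?_ h7
    calc c * A * (Y / B) ^ (i + 1) = c * (Y ^ (e + i + 1) * (Y * ε / B)) := by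
          rw [← hYA, div_pow]; field_simp; ring
      _ ≤ (3 * Y / B) ^ (i + 1) := h5
      _ = _ := by rw [← mul_pow]; congr 1; ring
  have h8 : 3 ^ (i + 1) / c + 1 ≤ A := le_max_left _ _
  have h9 : c * (3 ^ (i + 1) / c + 1) ≤ 3 ^ (i + 1) := (by gcongr : _ ≤ c * A).trans h6
  rw [mul_add, mul_div_cancel₀ _ hc.ne'] at h9
  linarith

/-- The value of the minimal polynomial in a pair with a small common factor cannot be both as
large as the resultant forces and as small as the counting argument forces. -/
theorem ApproxBound.false_of_exponents {n k m : ℕ} {ξ ω ω' κ : ℝ} (hξ : Transcendental ℚ ξ)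
    (hω : 0 ≤ ω) (hω' : 0 ≤ ω') (hκ : 0 ≤ κ) (h : ApproxBound n ξ ω) (h' : ApproxBound k ξ ω')
    (hV : ValueBound m ξ κ) (hkn : k ≤ n) (hnk : n < 2 * k) (hk : 3 ≤ k) (hkm : k ≤ 2 * m + 1)
    (hκ1 : κ ≤ k - 1) (hκ2 : 3 * κ ≤ 2 * k + 2 * ω' - 1) (hωk : ω < k + 1) (hωn : n ≤ k + ω)
    (hexp : 2 * (k + ω' + 1) * (k + ω - n) < 3 * (ω + 1) * (2 * k - n)) : False := by
  obtain ⟨K₀, hK₀, hpair⟩ := exists_minimal_pair hξ hκ hV (by linarith) hkm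
  obtain ⟨c₁, hc₁, x₁, hlow⟩ := h'.minimal_pair_lower_bound hω' hV hk hκ1 hκ2 hK₀
  obtain ⟨c₂, hc₂, hdim⟩ := h.le_of_le_finrank hξ hω hkn hnk hωk
  obtain ⟨A, hA, hspan⟩ := exists_lt_finrank_ratSpan (ξ := ξ) (K₀ := K₀) hkn hnk
  set e : ℝ := n - k + 1 with he
  have hepos : 0 < e := by
    have : (k : ℝ) ≤ n := by exact_mod_cast hkn
    linarith
  set gap : ℝ := 3 * (ω + 1) * (2 * k - n) - 2 * (k + ω' + 1) * (k + ω - n) with hgap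
  have hgappos : 0 < gap := by rw [hgap]; linarith
  set D : ℝ := (ω + 1) * Real.log A - e * Real.log c₂ - (k + ω - n) * Real.log c₁ with hD
  obtain ⟨B, hBx, hB1, P, Q, hP0, hQ0, hPk, hQk, hPB, hQB, hQP, hPK, hmin, hgcd⟩ :=
    hpair (max x₁ (Real.exp (|3 * D| / gap + 1)))
  have hlowP := hlow B P Q ((le_max_left _ _).trans hBx) hB1 hP0 hQ0 hPk hQk hPB hQB hQP hPK hgcd
  have hBpos : 0 < B := by linarith
  set ε := |aeval ξ P| with hε
  have hεpos : 0 < ε := abs_pos.2 (aeval_ne_zero_of_transcendental hξ hP0)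
  have hεB : ε ≤ B := by
    have := hmin 1 one_ne_zero (by simp) (by
      refine (supNorm_le_of_coeff fun i => ?_).trans hB1
      rw [coeff_one]; split_ifs <;> simp)
    simp only [map_one, abs_one] at this
    linarith
  set b := Real.log B with hb
  set s := Real.log ε with hs
  set y := (Real.log A - s - (2 * k - n - 1) * b) / e with hy
  have hey : e * y = Real.log A - s - (2 * k - n - 1) * b := by rw [hy]; field_simp
  have hYA : Real.exp y ^ (n - k + 1) * (ε * B ^ (2 * k - n - 1)) = A := by
    have h1 : 0 < Real.exp y ^ (n - k + 1) * (ε * B ^ (2 * k - n - 1)) := by positivity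
    apply Real.log_injOn_pos h1 hA
    rw [Real.log_mul (by positivity) (by positivity), Real.log_mul (by positivity) (by positivity),
      Real.log_pow, Real.log_pow, Real.log_exp, Nat.sub_sub]
    push_cast [Nat.cast_sub hkn, Nat.cast_sub (show n + 1 ≤ 2 * k by omega)]
    linarith
  obtain ⟨hBY, hfr⟩ := hspan B ε (Real.exp y) hB1 hεpos hεB hPK hmin (Real.exp_pos _) hYA
  have hfin := hdim _ _ (hB1.trans hBY) hfr
  have hlog1 : Real.log c₂ - ω * y ≤ y + s - b := by
    have := Real.log_le_log (by positivity) hfin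
    rw [Real.log_mul (by positivity) (by positivity), Real.log_rpow (by positivity),
      Real.log_div (by positivity) (by positivity), Real.log_mul (by positivity) (by positivity),
      Real.log_exp] at this
    linarith
  have hlog2 : Real.log c₁ - (2 * k + 2 * ω' - 1) / 3 * b ≤ s := by
    have := Real.log_le_log (by positivity) hlowP
    rw [Real.log_mul (by positivity) (by positivity), Real.log_rpow (by positivity)] at this
    linarith
  have hbig : |3 * D| / gap + 1 ≤ b := by
    rw [hb, Real.le_log_iff_exp_le hBpos]
    exact (le_max_right _ _).trans hBx
  have h1 : e * (Real.log c₂ + b) ≤ e * s + (ω + 1) * (e * y) := by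
    have := mul_le_mul_of_nonneg_left hlog1 hepos.le
    linarith
  rw [hey] at h1
  have h2 : (k + ω - n) * (Real.log c₁ - (2 * k + 2 * ω' - 1) / 3 * b) ≤ (k + ω - n) * s :=
    mul_le_mul_of_nonneg_left hlog2 (by linarith)
  have h3 : gap * b ≤ 3 * D := by
    rw [hgap, hD]
    rw [he] at h1 ⊢
    linarith
  have h4 : |3 * D| + gap ≤ gap * b := by
    calc |3 * D| + gap = gap * (|3 * D| / gap + 1) := by field_simp
      _ ≤ _ := by gcongr
  linarith [le_abs_self (3 * D)]

theorem ne_of_isIntegerMinpoly {P : ℤ[X]} {α ξ : ℝ} (hξ : Transcendental ℚ ξ)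
    (h : IsIntegerMinpoly P α) : α ≠ ξ := by
  rintro rfl
  exact aeval_ne_zero_of_transcendental hξ h.2.1.ne_zero h.2.2

theorem approxBound_of_wStar_lt {n : ℕ} {ξ ω : ℝ} (hξ : Transcendental ℚ ξ) (hω : -1 ≤ ω)
    (h : wStar n ξ < (ω : EReal)) : ApproxBound n ξ ω := by
  have hfin : (wirsingSolutions n ξ ω).Finite := by
    by_contra hinf
    exact absurd h (not_lt.2 (le_sSup ⟨ω, rfl, hinf⟩))
  have hmem : ξ ∈ (wirsingSolutions n ξ ω)ᶜ := by
    rintro ⟨P, hP, -, -⟩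
    exact ne_of_isIntegerMinpoly hξ hP rfl
  obtain ⟨d, hd, hball⟩ := Metric.isOpen_iff.1 hfin.isClosed.isOpen_compl ξ hmem
  refine ⟨min 1 d, by positivity, fun α P hP hdeg => ?_⟩
  have hH : 1 ≤ P.supNorm := one_le_supNorm hP.2.1.ne_zero
  have hHpow : 0 < P.supNorm ^ (-ω - 1) := by positivity
  by_cases hα : α ∈ wirsingSolutions n ξ ω
  · have h1 : d ≤ |ξ - α| := by
      by_contra hlt
      refine hball ?_ hα
      rw [Metric.mem_ball, Real.dist_eq, abs_sub_comm]
      exact not_le.1 hlt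
    have h2 : P.supNorm ^ (-ω - 1) ≤ 1 := Real.rpow_le_one_of_one_le_of_nonpos hH (by linarith)
    calc min 1 d * P.supNorm ^ (-ω - 1) ≤ d * 1 := by gcongr; exact min_le_right _ _
      _ ≤ _ := by rwa [mul_one]
  · have h1 : P.supNorm ^ (-ω - 1) ≤ |ξ - α| := by
      by_contra hlt
      exact hα ⟨P, hP, hdeg, not_le.1 hlt⟩
    calc min 1 d * P.supNorm ^ (-ω - 1) ≤ 1 * P.supNorm ^ (-ω - 1) := by
          gcongr; exact min_le_left _ _
      _ ≤ _ := by rwa [one_mul]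

theorem ApproxBound.mono_degree {k n : ℕ} {ξ ω : ℝ} (hkn : k ≤ n) (h : ApproxBound n ξ ω) :
    ApproxBound k ξ ω :=
  let ⟨c, hc, hb⟩ := h
  ⟨c, hc, fun α P hP hdeg => hb α P hP (hdeg.trans hkn)⟩

theorem one_div_sqrt_three_bounds : (0.5773 : ℝ) < 1 / √3 ∧ 1 / √3 < (0.5774 : ℝ) := by
  have h3 : (0 : ℝ) < √3 := by positivity
  have hsq : √3 * √3 = 3 := Real.mul_self_sqrt (by norm_num)
  constructor
  · rw [lt_div_iff₀ h3]; nlinarith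
  · rw [div_lt_iff₀ h3]; nlinarith

theorem exponents_eventually {s n k m : ℝ} (hs : 3 * s ^ 2 = n ^ 2)
    (hk1 : 2 * k ≤ n + s + 2) (hk2 : n + s < 2 * k) (hsk : s < k - 1) (hm : 2 * m ≤ k)
    (hs1 : 0.5773 * n < s) (hs2 : s < 0.5774 * n) :
    ∀ᶠ ω in nhdsWithin s (Set.Ioi s), s < ω ∧ ω < k - 1 ∧ ω < n - m + 1 ∧
      2 * (k + ω + 1) * (k + ω - n) < 3 * (ω + 1) * (2 * k - n) := by
  have hF : 2 * (k + s + 1) * (k + s - n) < 3 * (s + 1) * (2 * k - n) := by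
    have hn : 0 < n := by linarith
    have hu : (2 * k - (n + s + 2)) ^ 2 ≤ 4 := by nlinarith
    linarith [show 3 * (s + 1) * (2 * k - n) - 2 * (k + s + 1) * (k + s - n) =
      n + 2 - (2 * k - (n + s + 2)) ^ 2 / 2 by linear_combination (-1 / 2 : ℝ) * hs]
  have h1 : ∀ᶠ ω in nhds s, ω < k - 1 := eventually_lt_nhds hsk
  have h2 : ∀ᶠ ω in nhds s, ω < n - m + 1 := eventually_lt_nhds (by linarith)
  have h3 : ∀ᶠ ω in nhds s, 2 * (k + ω + 1) * (k + ω - n) < 3 * (ω + 1) * (2 * k - n) :=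
    (ContinuousAt.eventually_lt (by fun_prop) (by fun_prop) hF)
  filter_upwards [self_mem_nhdsWithin, nhdsWithin_le_nhds h1, nhdsWithin_le_nhds h2,
    nhdsWithin_le_nhds h3] with ω a b c d
  exact ⟨a, b, c, d⟩

theorem lt_wStar {n : ℕ} {ξ : ℝ} (hξ : Transcendental ℚ ξ) (hn : 4 ≤ n) :
    (((1 / √3) * (n : ℝ) : ℝ) : EReal) < wStar n ξ := by
  by_contra hle
  rw [not_lt] at hle
  set s : ℝ := 1 / √3 * n with hs
  have hnR : (4 : ℝ) ≤ n := by exact_mod_cast hn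
  obtain ⟨hb1, hb2⟩ := one_div_sqrt_three_bounds
  have hs1 : 0.5773 * (n : ℝ) < s := by rw [hs]; gcongr
  have hs2 : s < 0.5774 * (n : ℝ) := by rw [hs]; gcongr
  have hs3 : 3 * s ^ 2 = (n : ℝ) ^ 2 := by
    rw [hs, mul_pow, div_pow, Real.sq_sqrt (by norm_num)]
    ring
  set k : ℕ := ⌊(n + s + 2) / 2⌋₊ with hk
  have hk1 : (k : ℝ) ≤ (n + s + 2) / 2 := Nat.floor_le (by linarith)
  have hk2 : (n + s + 2) / 2 < k + 1 := Nat.lt_floor_add_one _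
  have hkn : k ≤ n := by
    have : (k : ℝ) < n + 1 := by linarith
    exact Nat.lt_succ_iff.1 (by exact_mod_cast this)
  have hnk : n < 2 * k := by
    have : (n : ℝ) < 2 * k := by linarith
    exact_mod_cast this
  have hk4 : 4 ≤ k := by
    rw [hk]
    apply Nat.le_floor
    push_cast
    linarith
  have hk4R : (4 : ℝ) ≤ k := by exact_mod_cast hk4
  have hsk : s < k - 1 := by
    rcases hn.eq_or_lt with rfl | h5
    · push_cast at hs2
      linarith
    · have : (5 : ℝ) ≤ n := by exact_mod_cast h5
      linarith
  have hm : 2 * ((k / 2 : ℕ) : ℝ) ≤ k := by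
    exact_mod_cast Nat.mul_div_le k 2
  obtain ⟨ω, hsω, hωk, hωm, hexp⟩ := (exponents_eventually (m := ((k / 2 : ℕ) : ℝ)) hs3
    (by linarith) (by linarith) hsk hm hs1 hs2).exists
  have hA : ApproxBound n ξ ω := approxBound_of_wStar_lt hξ (by linarith)
    (hle.trans_lt (by exact_mod_cast hsω))
  have hV : ValueBound (k / 2) ξ ω := hA.valueBound hξ (by linarith) (by omega) (by
    push_cast [Nat.cast_sub (show k / 2 ≤ n by omega)] at hωm ⊢
    exact hωm)
  exact hA.false_of_exponents hξ (by linarith) (by linarith) (by linarith)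
    (hA.mono_degree hkn) hV hkn hnk (by omega) (by omega) hωk.le (by linarith) (by linarith)
    (by linarith) hexp

theorem le_lowerWStar {ξ : ℝ} (hξ : Transcendental ℚ ξ) :
    ((1 / √3 : ℝ) : EReal) ≤ lowerWStar ξ := by
  refine le_liminf_of_le (by isBoundedDefault) ?_
  filter_upwards [eventually_ge_atTop 4] with n hn
  have hn0 : (0 : ℝ) < n := by
    have : 0 < n := by omega
    exact_mod_cast this
  rw [EReal.le_div_iff_mul_le (by exact_mod_cast hn0) (EReal.coe_ne_top _), ← EReal.coe_mul]
  exact (lt_wStar hξ hn).le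

theorem exists_root_wirsingQ : ∃ t : ℝ, 0.2345 < t ∧ t < 0.2346 ∧ wirsingQ t = 0 := by
  have hcont : ContinuousOn wirsingQ (Set.Icc 0.2345 0.2346) := by
    unfold wirsingQ
    fun_prop
  have hmem : (0 : ℝ) ∈ Set.Ioo (wirsingQ 0.2346) (wirsingQ 0.2345) := by
    constructor <;> norm_num [wirsingQ]
  obtain ⟨t, ht, h0⟩ := intermediate_value_Ioo' (by norm_num) hcont hmem
  exact ⟨t, ht.1, ht.2, h0⟩

theorem wirsingQ_injOn : Set.InjOn wirsingQ (Set.Ioo 0 (1 / 2)) := by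
  rintro a ⟨ha0, ha1⟩ b ⟨hb0, hb1⟩ hab
  have hfac : (a - b) * (4 * ((a ^ 2 + b ^ 2) * (a + b)) - 12 * (a ^ 2 + a * b + b ^ 2) +
      10 * (a + b) - 6) = 0 := by
    unfold wirsingQ at hab
    linear_combination hab
  rcases mul_eq_zero.1 hfac with h | h
  · linarith
  · have h1 : (a ^ 2 + b ^ 2) * (a + b) ≤ a ^ 2 + b ^ 2 :=
      mul_le_of_le_one_right (by positivity) (by linarith)
    nlinarith [sq_nonneg (a - b), sq_nonneg (7 * (a + b) - 5)]

/-- The value at `x` of the quadratic polynomial of which `wirsingG t` is the positive root. -/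
def wirsingQuadratic (t x : ℝ) : ℝ :=
  2 * (1 - t) * x ^ 2 + (2 * t ^ 2 + 2 * t - 1) * x - 2 * t * (1 - t)

theorem wirsingG_comparison {t x : ℝ} (ht0 : 0 < t) (ht1 : t < 1) (hx : 0 < x) :
    (x < wirsingG t ↔ wirsingQuadratic t x < 0) ∧
      (wirsingG t < x ↔ 0 < wirsingQuadratic t x) := by
  set b : ℝ := 2 * t ^ 2 + 2 * t - 1 with hb
  set d : ℝ := 4 * t ^ 4 + 24 * t ^ 3 - 32 * t ^ 2 + 12 * t + 1 with hd
  have hdb : d = b ^ 2 + 16 * t * (1 - t) ^ 2 := by rw [hd, hb]; ring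
  have h1t : 0 < 1 - t := by linarith
  have hgap : 0 < 16 * t * (1 - t) ^ 2 := by positivity
  have hd0 : 0 ≤ d := by rw [hdb]; positivity
  have hr2 : √d * √d = d := Real.mul_self_sqrt hd0
  have habs : |b| < √d := by
    rw [← Real.sqrt_sq_eq_abs]
    exact Real.sqrt_lt_sqrt (sq_nonneg b) (by linarith)
  have hden : 0 < b + √d := by linarith [neg_abs_le b]
  have hG : wirsingG t = (√d - b) / (4 * (1 - t)) := by
    rw [wirsingG, ← hb, ← hd, div_eq_div_iff hden.ne' (by positivity)]
    linear_combination -hr2 - hdb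
  have hfac : 8 * (1 - t) * wirsingQuadratic t x =
      (4 * (1 - t) * x + b + √d) * (4 * (1 - t) * x - (√d - b)) := by
    rw [wirsingQuadratic, ← hb]
    linear_combination hr2 + hdb
  have hpos : 0 < 4 * (1 - t) * x + b + √d := by nlinarith
  have h8 : 0 < 8 * (1 - t) := by positivity
  have h4 : 0 < 4 * (1 - t) := by positivity
  have hneg : ∀ {a z : ℝ}, 0 < a → (a * z < 0 ↔ z < 0) := fun ha => smul_neg_iff_of_pos_left ha
  rw [hG, lt_div_iff₀ h4, div_lt_iff₀ h4]
  constructor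
  · rw [← hneg h8, hfac, hneg hpos, sub_neg, mul_comm x]
  · rw [← mul_pos_iff_of_pos_left h8, hfac, mul_pos_iff_of_pos_left hpos, sub_pos, mul_comm x]

theorem wirsingG_bounds {t : ℝ} (h1 : 0.2345 < t) (h2 : t < 0.2346) :
    0.6408 < wirsingG t ∧ wirsingG t < 0.6409 := by
  constructor
  · rw [(wirsingG_comparison (by linarith) (by linarith) (by norm_num)).1, wirsingQuadratic]
    nlinarith
  · rw [(wirsingG_comparison (by linarith) (by linarith) (by norm_num)).2, wirsingQuadratic]
    nlinarith

theorem exponents_of_wirsingQuadratic_neg {t δ n k : ℝ} (ht0 : 0 < t) (ht1 : t < 1 / 2)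
    (htδ : t < δ) (hδ1 : δ < 1) (hn : 8 < -wirsingQuadratic t δ * n) (hn0 : 0 < n)
    (hk1 : k ≤ (1 - t) * n) (hk2 : (1 - t) * n - 1 < k) (hnk : n ≤ k + δ * n)
    (h2k : n ≤ 2 * k) :
    2 * (k + δ * k + 1) * (k + δ * n - n) < 3 * (δ * n + 1) * (2 * k - n) := by
  have hδ0 : 0 < δ := by linarith
  have h1 : (k + δ * k + 1) * (k + δ * n - n) ≤
      ((1 + δ) * (1 - t) * n + 1) * ((δ - t) * n) := by
    apply mul_le_mul _ (by linarith) (by linarith)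
    · have : 0 < 1 - t := by linarith
      positivity
    · nlinarith
  have h2 : 3 * (δ * n) * ((1 - 2 * t) * n - 2) ≤ 3 * (δ * n + 1) * (2 * k - n) := by
    have h3 : 3 * (δ * n) * ((1 - 2 * t) * n - 2) ≤ 3 * (δ * n) * (2 * k - n) := by
      apply mul_le_mul_of_nonneg_left _ (by positivity)
      linarith
    linarith
  have h3 : 8 * n < -wirsingQuadratic t δ * n * n := by gcongr
  rw [wirsingQuadratic] at h3
  nlinarith [mul_pos hn0 hδ0, mul_pos hn0 ht0, mul_pos hn0 (sub_pos.2 hδ1)]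

theorem wirsingG_le_upperWStar {t ξ : ℝ} (hξ : Transcendental ℚ ξ) (ht1 : 0.2345 < t)
    (ht2 : t < 0.2346) : (wirsingG t : EReal) ≤ upperWStar ξ := by
  by_contra hlt
  rw [not_le] at hlt
  obtain ⟨hG1, hG2⟩ := wirsingG_bounds ht1 ht2
  have hlt' : max ((0.64 : ℝ) : EReal) (upperWStar ξ) < (wirsingG t : EReal) :=
    max_lt (by exact_mod_cast (by linarith : (0.64 : ℝ) < wirsingG t)) hlt
  obtain ⟨δ, hδ1, hδ2⟩ := EReal.lt_iff_exists_real_btwn.1 hlt'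
  have hδlow : (0.64 : ℝ) < δ := by exact_mod_cast (le_max_left _ _).trans_lt hδ1
  have hδG : δ < wirsingG t := by exact_mod_cast hδ2
  have hquad := ((wirsingG_comparison (by linarith) (by linarith) (by linarith)).1).1 hδG
  have hev := eventually_lt_of_limsup_lt ((le_max_right _ _).trans_lt hδ1)
  obtain ⟨N₀, hN₀⟩ := eventually_atTop.1 hev
  have hA : ∀ n : ℕ, N₀ ≤ n → 0 < n → ApproxBound n ξ (δ * n) := by
    intro n hn hn0
    have hnR : (0 : ℝ) < n := by exact_mod_cast hn0
    refine approxBound_of_wStar_lt hξ (by nlinarith) ?_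
    have := hN₀ n hn
    rw [EReal.div_lt_iff (by exact_mod_cast hnR) (EReal.coe_ne_top _)] at this
    rwa [EReal.coe_mul]
  obtain ⟨p, hp⟩ := exists_nat_gt (max (max (N₀ : ℝ) 4) (8 / -wirsingQuadratic t δ))
  have hpN : N₀ < p := by
    exact_mod_cast ((le_max_left _ _).trans (le_max_left _ _)).trans_lt hp
  have hp4 : (4 : ℝ) < p := ((le_max_right _ _).trans (le_max_left _ _)).trans_lt hp
  have hpη : 8 < -wirsingQuadratic t δ * p := by
    have := (le_max_right _ _).trans_lt hp
    rwa [div_lt_iff₀' (by linarith)] at this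
  set k : ℕ := ⌊(1 - t) * (10 * p : ℕ)⌋₊ with hk
  have hk1 : (k : ℝ) ≤ (1 - t) * (10 * p : ℕ) := Nat.floor_le (by
    have : 0 ≤ 1 - t := by linarith
    positivity)
  have hk2 : (1 - t) * (10 * p : ℕ) < k + 1 := Nat.lt_floor_add_one _
  have htp1 : 0.2345 * (p : ℝ) < t * p := by gcongr
  have htp2 : t * p < 0.2346 * (p : ℝ) := by gcongr
  have hδp1 : 0.64 * (p : ℝ) < δ * p := by gcongr
  have hδp2 : δ * p < 0.6409 * (p : ℝ) := by gcongr; linarith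
  have hkup : (k : ℝ) < 7.66 * p := by push_cast at hk1; linarith
  have hklow : 7.65 * (p : ℝ) - 1 < k := by push_cast at hk2; linarith
  have hm : ((k / 2 : ℕ) : ℝ) ≤ k / 2 := by
    have : 2 * ((k / 2 : ℕ) : ℝ) ≤ k := by exact_mod_cast Nat.mul_div_le k 2
    linarith
  have hkp : 7 * p < k := by
    have : (7 : ℝ) * p < k := by linarith
    exact_mod_cast this
  have hkp' : k < 8 * p := by
    have : (k : ℝ) < 8 * p := by linarith
    exact_mod_cast this
  have hp4' : 4 < p := by exact_mod_cast hp4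
  have hV : ValueBound (k / 2) ξ (δ * (11 * p : ℕ)) :=
    (hA (11 * p) (by omega) (by omega)).valueBound hξ (by positivity) (by omega) (by
      push_cast [Nat.cast_sub (show k / 2 ≤ 11 * p by omega)]
      linarith)
  have hδk : 0.64 * (k : ℝ) ≤ δ * k := by gcongr
  refine (hA (10 * p) (by omega) (by omega)).false_of_exponents hξ (by positivity)
    (by positivity) (by positivity) (hA k (by omega) (by omega)) hV (by omega) (by omega)
    (by omega) (by omega) ?_ ?_ ?_ ?_ ?_
  · push_cast; linarith
  · push_cast; linarith
  · push_cast; linarith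
  · push_cast; linarith
  · apply exponents_of_wirsingQuadratic_neg (t := t) (by linarith) (by linarith) (by linarith)
      (by linarith) _ _ hk1 (by linarith) _ _
    · push_cast; linarith
    · push_cast; nlinarith
    · push_cast; linarith
    · push_cast; linarith

theorem theorem1p1 (ξ : ℝ) (hξ : Transcendental ℚ ξ) :
    (∀ n : ℕ, 4 ≤ n → (((1 / Real.sqrt 3) * (n : ℝ) : ℝ) : EReal) < wStar n ξ) ∧
    ((1 / Real.sqrt 3 : ℝ) : EReal) ≤ lowerWStar ξ ∧
    (0.5773 < 1 / Real.sqrt 3 ∧ 1 / Real.sqrt 3 < 0.5774) ∧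
    ∃ γ₀ : ℝ, (0 < γ₀ ∧ γ₀ < 1 / 2 ∧ wirsingQ γ₀ = 0) ∧
      (∀ t : ℝ, 0 < t → t < 1 / 2 → wirsingQ t = 0 → t = γ₀) ∧
      (0.6408 < wirsingG γ₀ ∧ wirsingG γ₀ < 0.6409) ∧
      (wirsingG γ₀ : EReal) ≤ upperWStar ξ := by
  obtain ⟨γ, hγ1, hγ2, hγ⟩ := exists_root_wirsingQ
  refine ⟨fun n hn => lt_wStar hξ hn, le_lowerWStar hξ, one_div_sqrt_three_bounds,
    γ, ⟨by linarith, by linarith, hγ⟩, fun t ht0 ht1 ht => ?_, wirsingG_bounds hγ1 hγ2,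
    wirsingG_le_upperWStar hξ hγ1 hγ2⟩
  exact wirsingQ_injOn ⟨ht0, ht1⟩ ⟨by linarith, by linarith⟩ (ht.trans hγ.symm)
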